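/- Let $I$ be a finite alphabet with at least two letters and $A=(a_{ij})_{i,j\in I}$ a matrix with entries in $\{0,1\}$ and with at least one entry $1$ in each row and each column. Let $\mathcal O_A$ be the Cuntz--Krieger algebra, i.e. the universal $C^*$-algebra generated by partial isometries $S_i$ ($i\in I$) with $\sum_{j}S_jS_j^*=1$ and $S_i^*S_i=\sum_j a_{ij}S_jS_j^*$. For $n\ge 1$ let $\mathcal W^n$ be the set of words $w=(w_0,\dots,w_{n-1})\in I^n$ with $a_{w_kw_{k+1}}=1$ for $0\le k<n-1$, let $\mathcal W=\bigcup_{n\ge1}\mathcal W^n$, and put $S_w=S_{w_0}\cdots S_{w_{n-1}}$. Let $\Sigma_A=\{x\in I^{\mathbb N_0}: a_{x_kx_{k+1}}=1 \text{ for all } k\}$ with the product topology; $\mathcal C(\Sigma_A)$ is identified with a subalgebra of $\mathcal O_A$ through $\mathbf 1_{[w]}\mapsto S_wS_w^*$, where $[w]$ is the cylinder set of $w$. Let $H\in\mathcal C(\Sigma_A)$ be real-valued and $\beta\in\mathbb R$. The gauge action $\alpha_H^t$ ($t\in\mathbb R$) is the $*$-automorphism of $\mathcal O_A$ with $\alpha_H^t(S_j)=e^{itH}S_j$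 for $j\in I$. A state $\sigma$ on $\mathcal O_A$ is an $(H,\beta)$-KMS state if there is a norm-dense subset $D$ of $\mathcal O_A$ such that for all $X,Y\in D$ there is a bounded continuous function $F$ on the closed strip between $\operatorname{Im} z=0$ and $\operatorname{Im} z=\beta$, analytic in the interior of the strip, with $F(t)=\sigma(X\alpha_H^t(Y))$ and $F(t+i\beta)=\sigma(\alpha_H^t(Y)X)$ for all $t\in\mathbb R$. Let $m_\sigma$ be the Borel measure on $\Sigma_A$ that represents $\sigma|_{\mathcal C(\Sigma_A)}$. Let $\sigma$ be an $(H,\beta)$-KMS state on $\mathcal O_A$. Then $$\sigma(S_vS_w^*)=0\quad\text{for all } n\ge1 \text{ and all } v,w\in\mathcal W^n \text{ with } v\ne w.$$ If moreover $\beta\ne0$, $H\ge0$ and $m_\sigma(\{x\in\Sigma_A: H(x)=0\})=0$, then $$\sigma(S_vS_w^*)=0\quad\text{for all } v,w\in\mathcal W \text{ with } v\ne w,$$ and in particular $\sigma(X)=0$ for all $X$ in the norm closure of the linear span of $\{S_vS_w^*: v\in\mathcal W^m,\ w\in\mathcal W^n,\ m\ne n\}$. -/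

import Mathlib

open scoped ENNReal ComplexOrder

noncomputable section

namespace CuntzKrieger

universe u

/-- A transition matrix over the alphabet `I`: entries in `{0,1}`, and at least one entry equal
to one in each row and in each column. -/
structure TransitionMatrix (I : Type u) where
  /-- The entries. -/
  a : Matrix I I ℕ
  zero_or_one : ∀ i j, a i j = 0 ∨ a i j = 1
  row : ∀ i, ∃ j, a i j = 1
  col : ∀ j, ∃ i, a i j = 1

variable {I : Type u}

/-! ### The subshift of finite type -/

/-- The one-sided subshift `Σ_A`. -/
def Shift (A : TransitionMatrix I) : Type u := {x : ℕ → I // ∀ n, A.a (x n) (x (n + 1)) = 1}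

/-- The topology of `Σ_A`: induced by the product topology, `I` being discrete. -/
instance (A : TransitionMatrix I) : TopologicalSpace (Shift A) :=
  letI : TopologicalSpace I := ⊥
  inferInstanceAs (TopologicalSpace {x : ℕ → I // ∀ n, A.a (x n) (x (n + 1)) = 1})

instance (A : TransitionMatrix I) : T2Space (Shift A) :=
  letI : TopologicalSpace I := ⊥
  haveI : DiscreteTopology I := ⟨rfl⟩
  inferInstanceAs (T2Space {x : ℕ → I // ∀ n, A.a (x n) (x (n + 1)) = 1})

theorem continuous_coord (A : TransitionMatrix I) (n : ℕ) (s : Set I) :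
    IsClopen {x : Shift A | x.1 n ∈ s} := by
  let : TopologicalSpace I := ⊥
  have : DiscreteTopology I := ⟨rfl⟩
  have h : Continuous (fun x : {x : ℕ → I // ∀ n, A.a (x n) (x (n + 1)) = 1} => x.1 n) :=
    (continuous_apply n).comp continuous_subtype_val
  exact (isClopen_discrete s).preimage h

instance [Finite I] (A : TransitionMatrix I) : CompactSpace (Shift A) := by
  let : TopologicalSpace I := ⊥
  have : DiscreteTopology I := ⟨rfl⟩
  have h : IsClosed {x : ℕ → I | ∀ n, A.a (x n) (x (n + 1)) = 1} := by
    rw [Set.ofPred_forall]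
    refine isClosed_iInter fun n => ?_
    have hc : Continuous (fun x : ℕ → I => (x n, x (n + 1))) := by fun_prop
    exact (isClosed_discrete {p : I × I | A.a p.1 p.2 = 1}).preimage hc
  exact isCompact_iff_compactSpace.1 h.isCompact

instance (A : TransitionMatrix I) : MeasurableSpace (Shift A) := borel _

instance (A : TransitionMatrix I) : BorelSpace (Shift A) := ⟨rfl⟩

/-- The set `𝒲` of finite (non-empty) admissible words. -/
def words (A : TransitionMatrix I) : Set (List I) :=
  {w | w ≠ [] ∧ w.IsChain fun i j => A.a i j = 1}

/-- The cylinder set `[w]`. -/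
def cylinder (A : TransitionMatrix I) (w : List I) : Set (Shift A) :=
  {x | ∀ (k : ℕ) (hk : k < w.length), x.1 k = w[k]}

theorem isClopen_cylinder (A : TransitionMatrix I) (w : List I) : IsClopen (cylinder A w) := by
  have h : cylinder A w = ⋂ k ∈ Finset.range w.length,
      {x : Shift A | x.1 k ∈ {i | w[k]? = some i}} := by
    ext x
    simp only [cylinder, Set.mem_ofPred_eq, Set.mem_iInter, Finset.mem_range]
    refine forall_congr' fun k => forall_congr' fun hk => ?_
    rw [List.getElem?_eq_getElem hk, Option.some_inj, eq_comm]
  rw [h]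
  exact isClopen_biInter_finset fun k _ => continuous_coord A k _

theorem cylinder_cons_iff (A : TransitionMatrix I) (i : I) (w : List I) (x : Shift A) :
    x ∈ cylinder A (i :: w) ↔
      x.1 0 = i ∧ ∀ (k : ℕ) (hk : k < w.length), x.1 (k + 1) = w[k] := by
  constructor
  · intro h
    exact ⟨h 0 (by simp), fun k hk => h (k + 1) (by simpa using hk)⟩
  · rintro ⟨h0, h⟩ k hk
    cases k with
    | zero => simpa using h0
    | succ k => simpa using h k (by simpa using hk)

theorem exists_shift_of_head (A : TransitionMatrix I) (i : I) : ∃ x : Shift A, x.1 0 = i := by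
  choose f hf using A.row
  refine ⟨⟨fun n => f^[n] i, fun n => ?_⟩, rfl⟩
  have := hf (f^[n] i)
  rwa [← Function.iterate_succ_apply' f n i] at this

/-- Prepending a letter. -/
def Shift.cons {A : TransitionMatrix I} (i : I) (x : Shift A) (h : A.a i (x.1 0) = 1) : Shift A :=
  ⟨fun n => Nat.casesOn n i x.1, fun n => by
    cases n with
    | zero => exact h
    | succ n => exact x.2 n⟩

theorem cylinder_nonempty (A : TransitionMatrix I) :
    ∀ w ∈ words A, (cylinder A w).Nonempty := by
  rintro w ⟨hne, hw⟩
  induction w with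
  | nil => exact absurd rfl hne
  | cons i w ih =>
    cases w with
    | nil =>
      obtain ⟨x, hx⟩ := exists_shift_of_head A i
      exact ⟨x, (cylinder_cons_iff A i [] x).2 ⟨hx, fun k hk => absurd hk (by simp)⟩⟩
    | cons j w =>
      rw [List.isChain_cons_cons] at hw
      obtain ⟨x, hx⟩ := ih (by simp) hw.2
      have hx0 : x.1 0 = j := hx 0 (by simp)
      exact ⟨x.cons i (by rw [hx0]; exact hw.1), (cylinder_cons_iff A i _ _).2 ⟨rfl, hx⟩⟩

instance [Nonempty I] (A : TransitionMatrix I) : Nonempty (Shift A) :=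
  let ⟨x, _⟩ := exists_shift_of_head A (Classical.arbitrary I)
  ⟨x⟩

/-- The indicator function `1_[w]` as a continuous function. -/
def cylinderIndicator (A : TransitionMatrix I) (w : List I) : C(Shift A, ℂ) where
  toFun := (cylinder A w).indicator 1
  continuous_toFun := (continuous_const (y := (1 : ℂ))).indicator (by
    simp [(isClopen_cylinder A w).frontier_eq])

/-! ### Cuntz–Krieger families -/

/-- The product `S_w = S_{w₀} ⋯ S_{w_{n-1}}`. -/
def wordProd {B : Type*} [Monoid B] (S : I → B) (w : List I) : B := (w.map S).prod

variable [Fintype I]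

/-- The Cuntz–Krieger relations: partial isometries `S i` with
`∑ j, S j S j* = 1` and `S i* S i = ∑ j, a i j S j S j*`. -/
structure IsCKFamily (A : TransitionMatrix I) {B : Type*} [Ring B] [StarRing B] (S : I → B) :
    Prop where
  partialIsometry : ∀ i, S i * star (S i) * S i = S i
  sum_range : ∑ j, S j * star (S j) = 1
  star_mul_self : ∀ i, star (S i) * S i = ∑ j, A.a i j • (S j * star (S j))

section Family

variable {A : TransitionMatrix I} {B : Type*} [CStarAlgebra B] {S : I → B}

theorem IsCKFamily.norm_le_one (hS : IsCKFamily A S) (i : I) : ‖S i‖ ≤ 1 := by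
  have h1 : ‖star (S i) * S i‖ = ‖S i‖ * ‖S i‖ := CStarRing.norm_star_mul_self
  have h2 : ‖star (star (S i) * S i) * (star (S i) * S i)‖ = _ := CStarRing.norm_star_mul_self
  have h3 : star (star (S i) * S i) * (star (S i) * S i) = star (S i) * S i := by
    rw [star_mul, star_star, mul_assoc, ← mul_assoc (S i), hS.partialIsometry]
  rw [h3, h1] at h2
  by_contra h
  push Not at h
  have h4 : 1 < ‖S i‖ * ‖S i‖ := by nlinarith
  nlinarith

theorem IsCKFamily.star_mul_eq_zero (hS : IsCKFamily A S) {i j : I} (hij : i ≠ j) :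
    star (S i) * S j = 0 := by
  classical
  let := CStarAlgebra.spectralOrder B
  have := CStarAlgebra.spectralOrderedRing B
  have h : ∑ k, star (star (S k) * S j) * (star (S k) * S j) = star (S j) * S j := by
    have : ∀ k, star (star (S k) * S j) * (star (S k) * S j)
        = star (S j) * (S k * star (S k)) * S j := fun k => by
      simp only [star_mul, star_star, mul_assoc]
    simp only [this, ← Finset.sum_mul, ← Finset.mul_sum, hS.sum_range, mul_one]
  rw [← Finset.add_sum_erase _ _ (Finset.mem_univ j)] at h
  have h' : star (star (S j) * S j) * (star (S j) * S j) = star (S j) * S j := by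
    rw [star_mul, star_star, mul_assoc, ← mul_assoc (S j), hS.partialIsometry]
  rw [h', add_eq_left] at h
  have h0 := (Finset.sum_eq_zero_iff_of_nonneg
    (fun k _ => star_mul_self_nonneg (star (S k) * S j))).1 h i (by simp [hij])
  exact (CStarRing.star_mul_self_eq_zero_iff _).1 h0

theorem IsCKFamily.mul_eq_zero (hS : IsCKFamily A S) {i j : I} (hij : A.a i j ≠ 1) :
    S i * S j = 0 := by
  have h0 : A.a i j = 0 := (A.zero_or_one i j).resolve_right hij
  rw [← hS.partialIsometry i, mul_assoc (S i), hS.star_mul_self, mul_assoc, Finset.sum_mul]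
  rw [Finset.sum_eq_zero, mul_zero]
  intro k _
  by_cases hk : k = j
  · subst hk; simp [h0]
  · rw [smul_mul_assoc, mul_assoc, hS.star_mul_eq_zero hk, mul_zero, smul_zero]

/-- For `g` a function on words, the element `∑ g(w) S_w S_w*`, where `w` runs over the words of
length `n`. -/
def cylSum (S : I → B) : ℕ → (List I → ℂ) → B
  | 0, g => algebraMap ℂ B (g [])
  | n + 1, g => ∑ i, S i * cylSum S n (fun u => g (i :: u)) * star (S i)

theorem IsCKFamily.range_commute (hS : IsCKFamily A S) (n : ℕ) (g : List I → ℂ) (i : I) :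
    Commute (S i * star (S i)) (cylSum S n g) := by
  cases n with
  | zero => exact (Algebra.commutes _ _).symm
  | succ n =>
    have h1 : S i * star (S i) * cylSum S (n + 1) g
        = S i * cylSum S n (fun u => g (i :: u)) * star (S i) := by
      rw [cylSum, Finset.mul_sum, Finset.sum_eq_single i]
      · rw [← mul_assoc, ← mul_assoc, hS.partialIsometry]
      · intro j _ hj
        rw [← mul_assoc, ← mul_assoc, mul_assoc (S i), hS.star_mul_eq_zero hj.symm]; simp
      · simp
    have h2 : cylSum S (n + 1) g * (S i * star (S i))
        = S i * cylSum S n (fun u => g (i :: u)) * star (S i) := by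
      rw [cylSum, Finset.sum_mul, Finset.sum_eq_single i]
      · have := congrArg star (hS.partialIsometry i)
        simp only [star_mul, star_star] at this
        rw [mul_assoc, this]
      · intro j _ hj
        rw [mul_assoc, ← mul_assoc (star (S j)), hS.star_mul_eq_zero hj]; simp
      · simp
    exact h1.trans h2.symm

theorem IsCKFamily.source_commute (hS : IsCKFamily A S) (n : ℕ) (g : List I → ℂ) (i : I) :
    Commute (star (S i) * S i) (cylSum S n g) := by
  rw [hS.star_mul_self]
  exact Commute.sum_left _ _ _ fun j _ => (hS.range_commute n g j).smul_left _

theorem IsCKFamily.cylSum_mul (hS : IsCKFamily A S) (n : ℕ) (g h : List I → ℂ) :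
    cylSum S n (g * h) = cylSum S n g * cylSum S n h := by
  induction n generalizing g h with
  | zero => simp [cylSum]
  | succ n ih =>
    simp only [cylSum, Finset.sum_mul]
    refine Finset.sum_congr rfl fun i _ => ?_
    rw [Finset.mul_sum, Finset.sum_eq_single i]
    · have e : (fun u => (g * h) (i :: u)) = (fun u => g (i :: u)) * fun u => h (i :: u) := rfl
      rw [e, ih]
      set x := cylSum S n fun u => g (i :: u)
      set y := cylSum S n fun u => h (i :: u)
      have hc : star (S i) * S i * x = x * (star (S i) * S i) := hS.source_commute n _ i
      calc S i * (x * y) * star (S i) = (S i * star (S i) * S i) * x * y * star (S i) := by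
            rw [hS.partialIsometry]; simp only [mul_assoc]
        _ = S i * (star (S i) * S i * x) * y * star (S i) := by simp only [mul_assoc]
        _ = _ := by rw [hc]; simp only [mul_assoc]
    · intro j _ hj
      rw [mul_assoc, mul_assoc, ← mul_assoc (star (S i)), ← mul_assoc (star (S i)),
        hS.star_mul_eq_zero hj.symm]
      simp
    · simp

theorem cylSum_add (n : ℕ) (g h : List I → ℂ) :
    cylSum S n (g + h) = cylSum S n g + cylSum S n h := by
  induction n generalizing g h with
  | zero => simp [cylSum]
  | succ n ih =>
    simp only [cylSum, ← Finset.sum_add_distrib]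
    refine Finset.sum_congr rfl fun i _ => ?_
    rw [← add_mul, ← mul_add, ← ih]
    rfl

theorem cylSum_star (n : ℕ) (g : List I → ℂ) :
    cylSum S n (star g) = star (cylSum S n g) := by
  induction n generalizing g with
  | zero => exact algebraMap_star_comm (g [])
  | succ n ih =>
    simp only [cylSum, star_sum, star_mul, star_star, ← ih, mul_assoc]
    rfl

theorem IsCKFamily.cylSum_const (hS : IsCKFamily A S) (n : ℕ) (c : ℂ) :
    cylSum S n (fun _ => c) = algebraMap ℂ B c := by
  induction n with
  | zero => rfl
  | succ n ih =>
    simp only [cylSum, ih]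
    have : ∀ i, S i * algebraMap ℂ B c * star (S i) = algebraMap ℂ B c * (S i * star (S i)) :=
      fun i => by rw [← Algebra.commutes, mul_assoc]
    simp only [this, ← Finset.mul_sum, hS.sum_range, mul_one]

/-- `cylSum` as a `*`-homomorphism. -/
def IsCKFamily.cylHom (hS : IsCKFamily A S) (n : ℕ) : (List I → ℂ) →⋆ₐ[ℂ] B where
  toFun := cylSum S n
  map_one' := (hS.cylSum_const n 1).trans (map_one _)
  map_mul' := hS.cylSum_mul n
  map_zero' := (hS.cylSum_const n 0).trans (map_zero _)
  map_add' := cylSum_add n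
  commutes' := hS.cylSum_const n
  map_star' := cylSum_star n

theorem IsCKFamily.cylSum_take (hS : IsCKFamily A S) {n m : ℕ} (h : n ≤ m) (g : List I → ℂ) :
    cylSum S m (fun u => g (u.take n)) = cylSum S n (fun u => g (u.take n)) := by
  induction n generalizing m g with
  | zero => simp only [List.take_zero, hS.cylSum_const]
  | succ n ih =>
    obtain ⟨m, rfl⟩ : ∃ k, m = k + 1 := ⟨m - 1, by omega⟩
    simp only [cylSum, List.take_succ_cons]
    refine Finset.sum_congr rfl fun i _ => ?_
    rw [ih (by omega) fun u => g (i :: u)]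

theorem cylSum_congr (n : ℕ) (g h : List I → ℂ) (e : ∀ u, u.length = n → g u = h u) :
    cylSum S n g = cylSum S n h := by
  induction n generalizing g h with
  | zero => simp [cylSum, e [] rfl]
  | succ n ih =>
    simp only [cylSum]
    refine Finset.sum_congr rfl fun i _ => ?_
    rw [ih _ (fun u => h (i :: u)) fun u hu => e _ (by simp [hu])]

theorem IsCKFamily.cylSum_eq_zero (hS : IsCKFamily A S) (n : ℕ) (g : List I → ℂ)
    (e : ∀ u, u.length = n + 1 → u ∈ words A → g u = 0) : cylSum S (n + 1) g = 0 := by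
  classical
  induction n generalizing g with
  | zero =>
    have : ∀ i, g [i] = 0 := fun i => e [i] rfl ⟨by simp, by simp⟩
    simp [cylSum, this]
  | succ n ih =>
    rw [cylSum]
    refine Finset.sum_eq_zero fun i _ => ?_
    let h : List I → ℂ := fun u => if u.head?.any (fun j => A.a i j = 1) then g (i :: u) else 0
    have h1 : cylSum S (n + 1) h = 0 := by
      refine ih h fun u hu hw => ?_
      cases u with
      | nil => simp at hu
      | cons j u =>
        by_cases hij : A.a i j = 1
        · simp only [h, List.head?_cons, Option.any_some, hij, decide_true, if_true]
          exact e _ (by simpa using hu) ⟨by simp, List.isChain_cons_cons.2 ⟨hij, hw.2⟩⟩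
        · simp [h, hij]
    have h2 : S i * cylSum S (n + 1) (fun u => g (i :: u)) = S i * cylSum S (n + 1) h := by
      simp only [cylSum, Finset.mul_sum]
      refine Finset.sum_congr rfl fun j _ => ?_
      by_cases hij : A.a i j = 1
      · simp [h, hij]
      · rw [← mul_assoc, ← mul_assoc, hS.mul_eq_zero hij]
        simp only [← mul_assoc, hS.mul_eq_zero hij, zero_mul]
    rw [h2, h1]
    simp

theorem IsCKFamily.norm_cylSum_le (hS : IsCKFamily A S) (n : ℕ) (g : List I → ℂ) {ε : ℝ}
    (hε : 0 ≤ ε) (e : ∀ u, u.length = n + 1 → u ∈ words A → ‖g u‖ ≤ ε) :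
    ‖cylSum S (n + 1) g‖ ≤ ε := by
  classical
  let := CStarAlgebra.spectralOrder B
  have := CStarAlgebra.spectralOrderedRing B
  let g' : List I → ℂ := fun u => if u.length = n + 1 ∧ u ∈ words A then g u else 0
  have hg : cylSum S (n + 1) g = cylSum S (n + 1) g' := by
    rw [← sub_eq_zero]
    change hS.cylHom (n + 1) g - hS.cylHom (n + 1) g' = 0
    rw [← map_sub]
    exact hS.cylSum_eq_zero n _ fun u hu hw => by simp [g', hu, hw]
  have hg' : ∀ u, ‖g' u‖ ≤ ε := fun u => by
    by_cases hu : u.length = n + 1 ∧ u ∈ words A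
    · simpa [g', hu] using e u hu.1 hu.2
    · simpa [g', hu] using hε
  let s : List I → ℂ := fun u => (Real.sqrt (ε ^ 2 - ‖g' u‖ ^ 2) : ℝ)
  have hs : star g' * g' + star s * s = algebraMap ℂ (List I → ℂ) ((ε ^ 2 : ℝ) : ℂ) := by
    funext u
    have hn : 0 ≤ ε ^ 2 - ‖g' u‖ ^ 2 := by
      have := pow_le_pow_left₀ (norm_nonneg _) (hg' u) 2
      linarith
    have h1 : star (g' u) * g' u = ((‖g' u‖ ^ 2 : ℝ) : ℂ) := by
      rw [Complex.star_def, ← Complex.normSq_eq_conj_mul_self, Complex.normSq_eq_norm_sq]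
    have h2 : star (s u) * s u = ((ε ^ 2 - ‖g' u‖ ^ 2 : ℝ) : ℂ) := by
      simp only [s, Complex.star_def, Complex.conj_ofReal]
      rw [← Complex.ofReal_mul, Real.mul_self_sqrt hn]
    change star (g' u) * g' u + star (s u) * s u = ((ε ^ 2 : ℝ) : ℂ)
    rw [h1, h2, ← Complex.ofReal_add]
    congr 1
    ring
  have hle : star (hS.cylHom (n + 1) g') * hS.cylHom (n + 1) g'
      ≤ algebraMap ℂ B ((ε ^ 2 : ℝ) : ℂ) := by
    rw [← AlgHomClass.commutes (hS.cylHom (n + 1)), ← hs, map_add, map_mul, map_mul, map_star,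
      map_star]
    exact le_add_of_nonneg_right (star_mul_self_nonneg _)
  have := CStarAlgebra.norm_le_norm_of_nonneg_of_le (star_mul_self_nonneg _) hle
  rw [CStarRing.norm_star_mul_self] at this
  have h3 : ‖algebraMap ℂ B ((ε ^ 2 : ℝ) : ℂ)‖ ≤ ε ^ 2 := by
    rcases subsingleton_or_nontrivial B with hB | hB
    · rw [Subsingleton.elim (algebraMap ℂ B ((ε ^ 2 : ℝ) : ℂ)) 0, norm_zero]; positivity
    · rw [norm_algebraMap', Complex.norm_real, Real.norm_of_nonneg (by positivity)]
  rw [hg]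
  change ‖hS.cylHom (n + 1) g'‖ ≤ ε
  nlinarith [norm_nonneg (hS.cylHom (n + 1) g')]

theorem IsCKFamily.cylSum_prefix [DecidableEq I] (hS : IsCKFamily A S) (w : List I) (n : ℕ)
    (h : w.length ≤ n) :
    cylSum S n (fun u => if w <+: u then 1 else 0) = wordProd S w * star (wordProd S w) := by
  induction w generalizing n with
  | nil => simpa [wordProd] using hS.cylSum_const n 1
  | cons i w ih =>
    obtain ⟨n, rfl⟩ : ∃ k, n = k + 1 := ⟨n - 1, by simp at h; omega⟩
    have h0 : cylSum S n (fun _ => 0) = 0 := by simpa using hS.cylSum_const n 0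
    rw [cylSum, Finset.sum_eq_single i]
    · simp only [List.cons_prefix_cons, true_and]
      rw [ih n (by simpa using h)]
      simp only [wordProd, List.map_cons, List.prod_cons, star_mul, mul_assoc]
    · intro j _ hj
      simp [List.cons_prefix_cons, hj.symm, h0]
    · simp

end Family

/-! ### The embedding of `C(Σ_A)` -/

section Embedding

variable (A : TransitionMatrix I)

/-- A point of `[w]` if `[w]` is non-empty, and an arbitrary point otherwise. -/
def pickPoint [Nonempty I] (w : List I) : Shift A :=
  haveI := Classical.propDecidable
  if h : (cylinder A w).Nonempty then h.some else Classical.arbitrary _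

theorem pickPoint_mem [Nonempty I] {w : List I} (h : w ∈ words A) :
    pickPoint A w ∈ cylinder A w := by
  rw [pickPoint, dif_pos (cylinder_nonempty A w h)]
  exact (cylinder_nonempty A w h).some_mem

/-- Sampling of a function on `Σ_A` at the chosen points. -/
def sample [Nonempty I] : C(Shift A, ℂ) →⋆ₐ[ℂ] (List I → ℂ) where
  toFun f w := f (pickPoint A w)
  map_one' := rfl
  map_mul' _ _ := rfl
  map_zero' := rfl
  map_add' _ _ := rfl
  commutes' _ := rfl
  map_star' _ := rfl

theorem exists_uniform (f : C(Shift A, ℂ)) {ε : ℝ} (hε : 0 < ε) :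
    ∃ N : ℕ, ∀ x y : Shift A, (∀ k < N, x.1 k = y.1 k) → ‖f x - f y‖ < ε := by
  by_contra! hcon
  let K : ℕ → Set (Shift A × Shift A) := fun N =>
    {p | (∀ k < N, p.1.1 k = p.2.1 k) ∧ ε ≤ ‖f p.1 - f p.2‖}
  have hK : ∀ N, IsClosed (K N) := by
    intro N
    have h1 : ∀ k, IsClosed {p : Shift A × Shift A | p.1.1 k = p.2.1 k} := by
      intro k
      have : {p : Shift A × Shift A | p.1.1 k = p.2.1 k} =
          ⋃ i : I, {x : Shift A | x.1 k ∈ ({i} : Set I)} ×ˢ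
            {x : Shift A | x.1 k ∈ ({i} : Set I)} := by
        ext p
        simp [eq_comm]
      rw [this]
      exact isClosed_iUnion_of_finite fun i =>
        (continuous_coord A k _).1.prod (continuous_coord A k _).1
    have h2 : IsClosed {p : Shift A × Shift A | ε ≤ ‖f p.1 - f p.2‖} :=
      isClosed_le continuous_const
        ((f.continuous.comp continuous_fst).sub (f.continuous.comp continuous_snd)).norm
    have : K N = (⋂ k, ⋂ (_ : k < N), {p : Shift A × Shift A | p.1.1 k = p.2.1 k}) ∩
        {p : Shift A × Shift A | ε ≤ ‖f p.1 - f p.2‖} := by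
      ext p
      simp [K]
    rw [this]
    exact (isClosed_iInter fun k => isClosed_iInter fun _ => h1 k).inter h2
  obtain ⟨p, hp⟩ := IsCompact.nonempty_iInter_of_sequence_nonempty_isCompact_isClosed K
    (fun N p hp => ⟨fun k hk => hp.1 k (by omega), hp.2⟩)
    (fun N => by
      obtain ⟨x, y, h, h'⟩ := hcon N
      exact ⟨(x, y), h, h'⟩)
    (hK 0).isCompact hK
  rw [Set.mem_iInter] at hp
  have hxy : p.1 = p.2 := Subtype.ext (funext fun k => (hp (k + 1)).1 k (by omega))
  have := (hp 0).2
  rw [hxy, sub_self, norm_zero] at this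
  linarith

variable {A} {B : Type*} [CStarAlgebra B] {S : I → B}

theorem IsCKFamily.cauchySeq_cylHom [Nonempty I] (hS : IsCKFamily A S) (f : C(Shift A, ℂ)) :
    CauchySeq fun n => hS.cylHom n (sample A f) := by
  refine Metric.cauchySeq_iff'.2 fun ε hε => ?_
  obtain ⟨N, hN⟩ := exists_uniform A f (half_pos hε)
  refine ⟨N + 1, fun m hm => ?_⟩
  obtain ⟨m, rfl⟩ : ∃ k, m = k + 1 := ⟨m - 1, by omega⟩
  let g : List I → ℂ := fun u => sample A f (u.take (N + 1))
  have h1 : hS.cylHom (N + 1) (sample A f) = hS.cylHom (m + 1) g := by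
    change cylSum S _ _ = cylSum S _ _
    rw [hS.cylSum_take hm]
    exact cylSum_congr _ _ _ fun u hu => by rw [← hu, List.take_length]
  rw [dist_eq_norm, h1, ← map_sub]
  refine lt_of_le_of_lt (hS.norm_cylSum_le m _ (half_pos hε).le fun u hu hw => ?_) (half_lt_self hε)
  refine (hN _ _ fun k hk => ?_).le
  have hw' : u.take (N + 1) ∈ words A :=
    ⟨fun h => hw.1 (by
      have := congrArg List.length h
      simp at this
      exact this), hw.2.take _⟩
  rw [pickPoint_mem A hw k (by omega),
    pickPoint_mem A hw' k (by rw [List.length_take]; omega), List.getElem_take]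

/-- The `*`-homomorphism `C(Σ_A) → B` determined by a Cuntz–Krieger family `S` in `B`, as the limit
of the Riemann sums `∑_{|w| = n} f(x_w) S_w S_w*` with `x_w ∈ [w]`. It is the one that maps
`1_[w]` to `S_w S_w*`. -/
def IsCKFamily.funEmbed [Nonempty I] (hS : IsCKFamily A S) : C(Shift A, ℂ) →⋆ₐ[ℂ] B :=
  have lim (f : C(Shift A, ℂ)) := (cauchySeq_tendsto_of_complete (hS.cauchySeq_cylHom f)).choose_spec
  { toFun := fun f => (cauchySeq_tendsto_of_complete (hS.cauchySeq_cylHom f)).choose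
    map_one' := tendsto_nhds_unique (lim 1) (by simp)
    map_mul' := fun f g => tendsto_nhds_unique (lim (f * g)) (by
      simpa using (lim f).mul (lim g))
    map_zero' := tendsto_nhds_unique (lim 0) (by simp)
    map_add' := fun f g => tendsto_nhds_unique (lim (f + g)) (by
      simpa using (lim f).add (lim g))
    commutes' := fun c => tendsto_nhds_unique (lim (algebraMap _ _ c)) (by
      simp only [AlgHomClass.commutes]
      exact tendsto_const_nhds)
    map_star' := fun f => tendsto_nhds_unique (lim (star f)) (by
      simpa only [map_star] using (lim f).star) }

theorem IsCKFamily.tendsto_funEmbed [Nonempty I] (hS : IsCKFamily A S) (f : C(Shift A, ℂ)) :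
    Filter.Tendsto (fun n => hS.cylHom n (sample A f)) Filter.atTop (nhds (hS.funEmbed f)) :=
  (cauchySeq_tendsto_of_complete (hS.cauchySeq_cylHom f)).choose_spec

theorem prefix_iff_pickPoint [Nonempty I] {w u : List I} (hu : u ∈ words A)
    (h : w.length ≤ u.length) : pickPoint A u ∈ cylinder A w ↔ w <+: u := by
  have hp := pickPoint_mem A hu
  rw [List.prefix_iff_getElem]
  constructor
  · intro hx
    exact ⟨h, fun k hk => by rw [← hx k hk, hp k (by omega)]⟩
  · rintro ⟨_, hx⟩ k hk
    rw [hx k hk, hp k (by omega)]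

/-- The defining property of the embedding: `1_[w] ↦ S_w S_w*`. -/
theorem IsCKFamily.funEmbed_cylinder [Nonempty I] (hS : IsCKFamily A S) (w : List I) :
    hS.funEmbed (cylinderIndicator A w) = wordProd S w * star (wordProd S w) := by
  classical
  refine tendsto_nhds_unique (hS.tendsto_funEmbed _) ?_
  refine tendsto_const_nhds.congr' ?_
  filter_upwards [Filter.eventually_ge_atTop (w.length + 1)] with n hn
  obtain ⟨n, rfl⟩ : ∃ k, n = k + 1 := ⟨n - 1, by omega⟩
  rw [← hS.cylSum_prefix w (n + 1) (by omega), eq_comm, ← sub_eq_zero]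
  change hS.cylHom (n + 1) _ -
    hS.cylHom (n + 1) (fun u : List I => if w <+: u then (1 : ℂ) else 0) = 0
  rw [← map_sub]
  refine hS.cylSum_eq_zero n _ fun u hu hw => ?_
  have := prefix_iff_pickPoint (A := A) (w := w) hw (by omega)
  change (cylinder A w).indicator 1 (pickPoint A u) - (if w <+: u then (1 : ℂ) else 0) = 0
  by_cases h : w <+: u
  · rw [if_pos h, Set.indicator_of_mem (this.2 h)]; simp
  · rw [if_neg h, Set.indicator_of_notMem (mt this.1 h)]; simp

theorem IsCKFamily.cylSum_commute [Nonempty I] (hS : IsCKFamily A S) (f : C(Shift A, ℂ)) (n : ℕ)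
    (g : List I → ℂ) : Commute (cylSum S n g) (hS.funEmbed f) := by
  refine tendsto_nhds_unique ((hS.tendsto_funEmbed f).const_mul _)
    (((hS.tendsto_funEmbed f).mul_const _).congr' ?_)
  filter_upwards [Filter.eventually_ge_atTop n] with m hm
  have h : cylSum S n g = hS.cylHom m fun u => g (u.take n) := by
    refine Eq.trans ?_ (hS.cylSum_take hm g).symm
    exact cylSum_congr _ _ _ fun u hu => by rw [← hu, List.take_length]
  rw [h, ← map_mul, ← map_mul, mul_comm]

theorem IsCKFamily.funEmbed_commute [Nonempty I] (hS : IsCKFamily A S) (f : C(Shift A, ℂ)) (i : I) :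
    S i * star (S i) * hS.funEmbed f = hS.funEmbed f * (S i * star (S i)) := by
  have h := hS.funEmbed_cylinder [i]
  simp only [wordProd, List.map_cons, List.map_nil, List.prod_cons, List.prod_nil, mul_one] at h
  rw [← h, ← map_mul, ← map_mul, mul_comm]

/-- The family `e^{itH} S i`. -/
theorem IsCKFamily.twist [Nonempty I] (hS : IsCKFamily A S) (f : C(Shift A, ℂ))
    (hf : star f * f = 1) : IsCKFamily A fun i => hS.funEmbed f * S i := by
  have h1 : star (hS.funEmbed f) * hS.funEmbed f = 1 := by rw [← map_star, ← map_mul, hf, map_one]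
  have h2 : hS.funEmbed f * star (hS.funEmbed f) = 1 := by
    rw [← map_star, ← map_mul, mul_comm, hf, map_one]
  have h3 : ∀ i, hS.funEmbed f * S i * star (hS.funEmbed f * S i) = S i * star (S i) := fun i => by
    calc hS.funEmbed f * S i * star (hS.funEmbed f * S i)
        = hS.funEmbed f * (S i * star (S i)) * star (hS.funEmbed f) := by
          simp only [star_mul, mul_assoc]
      _ = _ := by rw [← hS.funEmbed_commute, mul_assoc, h2, mul_one]
  refine ⟨fun i => ?_, ?_, fun i => ?_⟩
  · rw [h3, ← mul_assoc, hS.funEmbed_commute, mul_assoc, hS.partialIsometry]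
  · simp only [h3, hS.sum_range]
  · simp only [h3]
    rw [star_mul, mul_assoc, ← mul_assoc (star (hS.funEmbed f)), h1, one_mul, hS.star_mul_self]

/-- Twisting does not change the embedding of `C(Σ_A)`. -/
theorem IsCKFamily.funEmbed_twist [Nonempty I] (hS : IsCKFamily A S) (f : C(Shift A, ℂ))
    (hf : star f * f = 1) (g : C(Shift A, ℂ)) :
    (hS.twist f hf).funEmbed g = hS.funEmbed g := by
  classical
  have h2 : hS.funEmbed f * star (hS.funEmbed f) = 1 := by
    rw [← map_star, ← map_mul, mul_comm, hf, map_one]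
  have key : ∀ n (g : List I → ℂ),
      cylSum (fun i => hS.funEmbed f * S i) n g = cylSum S n g := by
    intro n
    induction n with
    | zero => intro g; rfl
    | succ n ih =>
      intro g
      simp only [cylSum, ih]
      refine Finset.sum_congr rfl fun i _ => ?_
      have hi : cylSum S (n + 1) (fun u => if u.head? = some i then g u else 0)
          = S i * cylSum S n (fun u => g (i :: u)) * star (S i) := by
        rw [cylSum, Finset.sum_eq_single i]
        · simp
        · intro j _ hj
          have : cylSum S n (fun _ => 0) = 0 := by simpa using hS.cylSum_const n 0
          simp [hj, this]
        · simp
      have hc := hS.cylSum_commute f (n + 1) (fun u => if u.head? = some i then g u else 0)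
      rw [hi] at hc
      calc hS.funEmbed f * S i * cylSum S n (fun u => g (i :: u)) * star (hS.funEmbed f * S i)
          = hS.funEmbed f * (S i * cylSum S n (fun u => g (i :: u)) * star (S i)) *
            star (hS.funEmbed f) := by simp only [star_mul, mul_assoc]
        _ = _ := by rw [← hc.eq, mul_assoc, h2, mul_one]
  refine tendsto_nhds_unique ((hS.twist f hf).tendsto_funEmbed g)
    ((hS.tendsto_funEmbed g).congr fun n => (key n _).symm)

theorem map_cylSum {C : Type*} [CStarAlgebra C] (φ : B →⋆ₐ[ℂ] C) (n : ℕ) (g : List I → ℂ) :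
    φ (cylSum S n g) = cylSum (fun i => φ (S i)) n g := by
  induction n generalizing g with
  | zero => exact AlgHomClass.commutes φ _
  | succ n ih => simp only [cylSum, map_sum, map_mul, map_star, ih]

end Embedding

/-! ### The Cuntz–Krieger algebra -/

section Algebra

/-- The infinite-dimensional separable Hilbert space `ℓ²(ℕ)`. -/
abbrev Hilb : Type := lp (fun _ : ℕ => ℂ) 2

/-- All representations of the Cuntz–Krieger relations on `ℓ²(ℕ)`. -/
def CKRep (A : TransitionMatrix I) : Type u := {T : I → (Hilb →L[ℂ] Hilb) // IsCKFamily A T}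

instance : Nontrivial Hilb :=
  ⟨⟨lp.single 2 0 1, 0, fun h => by
    have := congrArg (fun x : Hilb => x 0) h
    simp at this⟩⟩

/-- All bounded families of operators on `ℓ²(ℕ)` indexed by the representations. -/
abbrev RawReps (A : TransitionMatrix I) : Type u := lp (fun _ : CKRep A => Hilb →L[ℂ] Hilb) ∞

/-- The C*-algebra structure, with the pointwise operations and the supremum norm. -/
@[reducible] def rawCStar (A : TransitionMatrix I) : CStarAlgebra (RawReps A) where

/-- The C*-algebra of all bounded families of operators indexed by the representations. -/
def AllReps (A : TransitionMatrix I) : Type u := RawReps A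

/-- The C*-algebra structure of `AllReps A`. -/
def allRepsCStar (A : TransitionMatrix I) : CStarAlgebra (AllReps A) := rawCStar A

attribute [instance] allRepsCStar

section AllReps

variable {A : TransitionMatrix I}

/-- The bounded family `x` as an element of the algebra. -/
def AllReps.mk (x : CKRep A → (Hilb →L[ℂ] Hilb)) (c : ℝ) (h : ∀ T, ‖x T‖ ≤ c) : AllReps A :=
  (⟨x, memℓp_infty ⟨c, by rintro _ ⟨T, rfl⟩; exact h T⟩⟩ : RawReps A)

/-- The underlying bounded family. -/
def AllReps.raw (x : AllReps A) : RawReps A := x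

/-- The component in the representation `T`. -/
def AllReps.eval (T : CKRep A) : AllReps A →⋆ₐ[ℂ] (Hilb →L[ℂ] Hilb) where
  toFun x := (AllReps.raw x).1 T
  map_one' := rfl
  map_mul' _ _ := rfl
  map_zero' := rfl
  map_add' _ _ := rfl
  commutes' _ := rfl
  map_star' _ := rfl

theorem AllReps.eval_mk (x : CKRep A → (Hilb →L[ℂ] Hilb)) (c : ℝ) (h : ∀ T, ‖x T‖ ≤ c)
    (T : CKRep A) : eval T (mk x c h) = x T := rfl

theorem AllReps.ext {x y : AllReps A} (h : ∀ T, eval T x = eval T y) : x = y :=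
  lp.ext (E := fun _ : CKRep A => Hilb →L[ℂ] Hilb) (p := ∞) (funext h)

theorem AllReps.norm_eval_le (x : AllReps A) (T : CKRep A) : ‖eval T x‖ ≤ ‖x‖ :=
  lp.norm_apply_le_norm ENNReal.top_ne_zero x.raw T

theorem AllReps.norm_le (x : AllReps A) (c : ℝ) (hc : 0 ≤ c) (h : ∀ T, ‖eval T x‖ ≤ c) :
    ‖x‖ ≤ c :=
  lp.norm_le_of_forall_le (f := x.raw) hc h

end AllReps

variable (A : TransitionMatrix I)

/-- The direct sum over all representations of their `i`-th partial isometries. -/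
def bigGen (i : I) : AllReps A := AllReps.mk (fun T => T.1 i) 1 fun T => T.2.norm_le_one i

/-- The C*-subalgebra generated by the direct sum of all representations of the Cuntz–Krieger
relations on `ℓ²(ℕ)`. -/
def ckSubalgebra : StarSubalgebra ℂ (AllReps A) :=
  (StarAlgebra.adjoin ℂ (Set.range (bigGen A))).topologicalClosure

/-- The Cuntz–Krieger algebra `𝒪_A`, the universal C*-algebra of the Cuntz–Krieger relations: the
C*-algebra generated by the direct sum of all representations of the relations on `ℓ²(ℕ)`.
(A C*-algebra generated by a finite family is separable, so it has, after infinite amplification,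
a faithful representation on `ℓ²(ℕ)` if it is not zero: all Cuntz–Krieger families are covered.) -/
def CKAlgebra : Type u := ckSubalgebra A

/-- The C*-algebra structure of `𝒪_A`. -/
def ckCStar : CStarAlgebra (CKAlgebra A) :=
  StarSubalgebra.cstarAlgebra (ckSubalgebra A)
    (h_closed := StarSubalgebra.isClosed_topologicalClosure _)

attribute [instance] ckCStar

/-- The inclusion of `𝒪_A` in the algebra of bounded families. -/
def incl : CKAlgebra A →⋆ₐ[ℂ] AllReps A where
  toFun x := (show ckSubalgebra A from x).1
  map_one' := rfl
  map_mul' _ _ := rfl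
  map_zero' := rfl
  map_add' _ _ := rfl
  commutes' _ := rfl
  map_star' _ := rfl

theorem incl_injective : Function.Injective (incl A) := fun _ _ h => Subtype.ext h

theorem norm_incl (x : CKAlgebra A) : ‖incl A x‖ = ‖x‖ := rfl

/-- The generators `S i` of `𝒪_A`. -/
def gen (i : I) : CKAlgebra A :=
  (⟨bigGen A i, StarSubalgebra.le_topologicalClosure _
    (StarAlgebra.subset_adjoin ℂ _ ⟨i, rfl⟩)⟩ : ckSubalgebra A)

theorem incl_gen (i : I) : incl A (gen A i) = bigGen A i := rfl

theorem eval_bigGen (i : I) (T : CKRep A) : AllReps.eval T (bigGen A i) = T.1 i := rfl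

theorem isCKFamily_bigGen : IsCKFamily A (bigGen A) where
  partialIsometry i := AllReps.ext fun T => by
    simpa only [eval_bigGen, map_mul, map_star] using T.2.partialIsometry i
  sum_range := AllReps.ext fun T => by
    simpa only [eval_bigGen, map_sum, map_mul, map_star, map_one] using T.2.sum_range
  star_mul_self i := AllReps.ext fun T => by
    simpa only [eval_bigGen, map_sum, map_mul, map_star, map_nsmul] using T.2.star_mul_self i

theorem isCKFamily_gen : IsCKFamily A (gen A) where
  partialIsometry i := incl_injective A (by
    simpa only [incl_gen, map_mul, map_star] using (isCKFamily_bigGen A).partialIsometry i)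
  sum_range := incl_injective A (by
    simpa only [incl_gen, map_sum, map_mul, map_star, map_one] using (isCKFamily_bigGen A).sum_range)
  star_mul_self i := incl_injective A (by
    simpa only [incl_gen, map_sum, map_mul, map_star, map_nsmul] using (isCKFamily_bigGen A).star_mul_self i)

variable {A}

/-- The image of a Cuntz–Krieger family under a `*`-homomorphism. -/
theorem IsCKFamily.map {B C : Type*} [CStarAlgebra B] [CStarAlgebra C] {V : I → B}
    (hV : IsCKFamily A V) (φ : B →⋆ₐ[ℂ] C) : IsCKFamily A fun i => φ (V i) where
  partialIsometry i := by
    simpa only [map_mul, map_star] using congrArg φ (hV.partialIsometry i)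
  sum_range := by
    simpa only [map_sum, map_mul, map_star, map_one] using congrArg φ hV.sum_range
  star_mul_self i := by
    simpa only [map_sum, map_mul, map_star, map_nsmul] using congrArg φ (hV.star_mul_self i)

/-- The component of a Cuntz–Krieger family of `𝒪_A` in the representation `T`. -/
def reindex {V : I → CKAlgebra A} (hV : IsCKFamily A V) (T : CKRep A) : CKRep A :=
  ⟨fun i => AllReps.eval T (incl A (V i)), (hV.map (incl A)).map (AllReps.eval T)⟩

/-- The `*`-homomorphism of the algebra of bounded families given by a map of the index set. -/
def pullback (φ : CKRep A → CKRep A) : AllReps A →⋆ₐ[ℂ] AllReps A where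
  toFun x := AllReps.mk (fun T => AllReps.eval (φ T) x) ‖x‖ fun T => AllReps.norm_eval_le x (φ T)
  map_one' := AllReps.ext fun T => by simp only [AllReps.eval_mk, map_one]
  map_mul' _ _ := AllReps.ext fun T => by simp only [AllReps.eval_mk, map_mul]
  map_zero' := AllReps.ext fun T => by simp only [AllReps.eval_mk, map_zero]
  map_add' _ _ := AllReps.ext fun T => by simp only [AllReps.eval_mk, map_add]
  commutes' _ := AllReps.ext fun T => by simp only [AllReps.eval_mk, AlgHomClass.commutes]
  map_star' _ := AllReps.ext fun T => by simp only [AllReps.eval_mk, map_star]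

theorem eval_pullback (φ : CKRep A → CKRep A) (x : AllReps A) (T : CKRep A) :
    AllReps.eval T (pullback φ x) = AllReps.eval (φ T) x := rfl

theorem continuous_pullback (φ : CKRep A → CKRep A) : Continuous (pullback φ) :=
  AddMonoidHomClass.continuous_of_bound (pullback φ) 1 fun x => by
    rw [one_mul]
    exact AllReps.norm_le _ _ (norm_nonneg _) fun T => AllReps.norm_eval_le x (φ T)

theorem pullback_mem {V : I → CKAlgebra A} (hV : IsCKFamily A V) (x : CKAlgebra A) :
    pullback (reindex hV) (incl A x) ∈ ckSubalgebra A := by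
  have h : ckSubalgebra A ≤ (ckSubalgebra A).comap (pullback (reindex hV)) := by
    refine StarSubalgebra.topologicalClosure_minimal (StarAlgebra.adjoin_le ?_) ?_
    · rintro _ ⟨i, rfl⟩
      exact (show ckSubalgebra A from V i).2
    · exact (StarSubalgebra.isClosed_topologicalClosure _).preimage
        (continuous_pullback (reindex hV))
  exact h (show ckSubalgebra A from x).2

/-- The map underlying `lift`. -/
def liftFun {V : I → CKAlgebra A} (hV : IsCKFamily A V) (x : CKAlgebra A) : CKAlgebra A :=
  (⟨pullback (reindex hV) (incl A x), pullback_mem hV x⟩ : ckSubalgebra A)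

theorem incl_liftFun {V : I → CKAlgebra A} (hV : IsCKFamily A V) (x : CKAlgebra A) :
    incl A (liftFun hV x) = pullback (reindex hV) (incl A x) := rfl

/-- A Cuntz–Krieger family `V` in `𝒪_A` gives the `*`-homomorphism `𝒪_A → 𝒪_A` with
`S i ↦ V i`. -/
def lift {V : I → CKAlgebra A} (hV : IsCKFamily A V) : CKAlgebra A →⋆ₐ[ℂ] CKAlgebra A where
  toFun := liftFun hV
  map_one' := incl_injective A (by simp only [incl_liftFun, map_one])
  map_mul' _ _ := incl_injective A (by simp only [incl_liftFun, map_mul])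
  map_zero' := incl_injective A (by simp only [incl_liftFun, map_zero])
  map_add' _ _ := incl_injective A (by simp only [incl_liftFun, map_add])
  commutes' _ := incl_injective A (by simp only [incl_liftFun, AlgHomClass.commutes])
  map_star' _ := incl_injective A (by simp only [incl_liftFun, map_star])

theorem incl_lift {V : I → CKAlgebra A} (hV : IsCKFamily A V) (x : CKAlgebra A) :
    incl A (lift hV x) = pullback (reindex hV) (incl A x) := rfl

theorem lift_gen {V : I → CKAlgebra A} (hV : IsCKFamily A V) (i : I) : lift hV (gen A i) = V i :=
  incl_injective A (AllReps.ext fun T => by rw [incl_lift, eval_pullback]; rfl)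

theorem continuous_lift {V : I → CKAlgebra A} (hV : IsCKFamily A V) : Continuous (lift hV) :=
  AddMonoidHomClass.continuous_of_bound (lift hV) 1 fun x => by
    rw [one_mul, ← norm_incl, incl_lift, ← norm_incl A x]
    refine AllReps.norm_le _ _ (norm_nonneg _) fun T => ?_
    rw [eval_pullback]
    exact AllReps.norm_eval_le _ _

/-- A `*`-homomorphism on `𝒪_A` is determined by the images of the generators. -/
theorem hom_ext {C : Type*} [CStarAlgebra C] {φ ψ : CKAlgebra A →⋆ₐ[ℂ] C} (hφ : Continuous φ)
    (hψ : Continuous ψ) (h : ∀ i, φ (gen A i) = ψ (gen A i)) : φ = ψ := by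
  refine StarAlgHom.ext_topologicalClosure (S := StarAlgebra.adjoin ℂ (Set.range (bigGen A)))
    hφ hψ (StarAlgHom.ext_adjoin ?_)
  rintro ⟨_, _⟩ ⟨i, rfl⟩
  exact h i

variable [Nonempty I]

variable (A) in
/-- The embedding `C(Σ_A) → 𝒪_A` with `1_[w] ↦ S_w S_w*`. -/
def embed : C(Shift A, ℂ) →⋆ₐ[ℂ] CKAlgebra A := (isCKFamily_gen A).funEmbed

/-- The function `e^{itH}`. -/
def expFun (H : C(Shift A, ℝ)) (t : ℝ) : C(Shift A, ℂ) :=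
  ⟨fun x => Complex.exp (Complex.I * t * H x), Complex.continuous_exp.comp
    (continuous_const.mul (Complex.continuous_ofReal.comp H.continuous))⟩

theorem star_expFun_mul (H : C(Shift A, ℝ)) (t : ℝ) : star (expFun H t) * expFun H t = 1 := by
  ext x
  change (starRingEnd ℂ) (Complex.exp (Complex.I * t * H x)) * Complex.exp (Complex.I * t * H x) = 1
  rw [← Complex.exp_conj, ← Complex.exp_add]
  simp

/-- The extension of `S j ↦ e^{itH} S j` to `𝒪_A`, as a `*`-homomorphism. -/
def gaugeHom (H : C(Shift A, ℝ)) (t : ℝ) : CKAlgebra A →⋆ₐ[ℂ] CKAlgebra A :=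
  lift ((isCKFamily_gen A).twist (expFun H t) (star_expFun_mul H t))

theorem gaugeHom_gen (H : C(Shift A, ℝ)) (t : ℝ) (j : I) :
    gaugeHom H t (gen A j) = embed A (expFun H t) * gen A j :=
  lift_gen _ j

theorem gaugeHom_embed (H : C(Shift A, ℝ)) (t : ℝ) (f : C(Shift A, ℂ)) :
    gaugeHom H t (embed A f) = embed A f := by
  have h := ((continuous_lift ((isCKFamily_gen A).twist (expFun H t)
    (star_expFun_mul H t))).tendsto _).comp ((isCKFamily_gen A).tendsto_funEmbed f)
  refine tendsto_nhds_unique h ?_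
  have e : embed A f = ((isCKFamily_gen A).twist (expFun H t) (star_expFun_mul H t)).funEmbed f :=
    ((isCKFamily_gen A).funEmbed_twist (expFun H t) (star_expFun_mul H t) f).symm
  rw [e]
  exact (((isCKFamily_gen A).twist (expFun H t) (star_expFun_mul H t)).tendsto_funEmbed f).congr
    fun n => (map_cylSum (S := gen A) (gaugeHom H t) n _).symm

theorem gaugeHom_neg (H : C(Shift A, ℝ)) (s t : ℝ) (h : s + t = 0) (x : CKAlgebra A) :
    gaugeHom H s (gaugeHom H t x) = x := by
  have key : (gaugeHom H s).comp (gaugeHom H t) = StarAlgHom.id ℂ (CKAlgebra A) := by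
    refine hom_ext ((continuous_lift _).comp (continuous_lift _)) continuous_id fun j => ?_
    change gaugeHom H s (gaugeHom H t (gen A j)) = gen A j
    rw [gaugeHom_gen, map_mul, gaugeHom_embed, gaugeHom_gen, ← mul_assoc, ← map_mul]
    have he : expFun H t * expFun H s = 1 := by
      ext x
      change Complex.exp _ * Complex.exp _ = 1
      rw [← Complex.exp_add]
      have hst : (s : ℂ) + t = 0 := by exact_mod_cast h
      have : Complex.I * t * H x + Complex.I * s * H x = Complex.I * H x * (s + t) := by ring
      rw [this, hst, mul_zero, Complex.exp_zero]
    rw [he, map_one, one_mul]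
  exact DFunLike.congr_fun key x

/-- The gauge action: the `*`-automorphism `α_H^t` of `𝒪_A` that extends `S j ↦ e^{itH} S j`. -/
def gauge (H : C(Shift A, ℝ)) (t : ℝ) : CKAlgebra A ≃⋆ₐ[ℂ] CKAlgebra A :=
  StarAlgEquiv.ofStarAlgHom (gaugeHom H t) (gaugeHom H (-t))
    (StarAlgHom.ext (gaugeHom_neg H (-t) t (by ring)))
    (StarAlgHom.ext (gaugeHom_neg H t (-t) (by ring)))

theorem gauge_gen (H : C(Shift A, ℝ)) (t : ℝ) (j : I) :
    gauge H t (gen A j) = embed A (expFun H t) * gen A j := by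
  exact gaugeHom_gen H t j

end Algebra

/-! ### KMS states -/

/-- States of a C*-algebra: linear functionals of norm one that are positive. -/
structure CState (B : Type*) [CStarAlgebra B] where
  /-- The functional. -/
  toFunctional : B →L[ℂ] ℂ
  norm_eq_one : ‖toFunctional‖ = 1
  nonneg : ∀ X : B, 0 ≤ toFunctional (star X * X)

instance (B : Type*) [CStarAlgebra B] : CoeFun (CState B) fun _ => B → ℂ where
  coe σ := σ.toFunctional

variable {A : TransitionMatrix I} [Nonempty I]

/-- `(H, β)`-KMS states: for all `X`, `Y` in some norm-dense subset there is a bounded continuous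
function `F` on the closed strip between `Im z = 0` and `Im z = β`, analytic in its interior, with
`F(t) = σ(X α_H^t(Y))` and `F(t + iβ) = σ(α_H^t(Y) X)` for all real `t`. -/
def IsKMSState (H : C(Shift A, ℝ)) (β : ℝ) (σ : CState (CKAlgebra A)) : Prop :=
  ∃ D : Set (CKAlgebra A), Dense D ∧ ∀ X ∈ D, ∀ Y ∈ D, ∃ F : ℂ → ℂ,
    ContinuousOn F {z | z.im ∈ Set.uIcc 0 β} ∧
    (∃ C : ℝ, ∀ z : ℂ, z.im ∈ Set.uIcc 0 β → ‖F z‖ ≤ C) ∧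
    DifferentiableOn ℂ F {z | z.im ∈ Set.uIoo 0 β} ∧
    ∀ t : ℝ, F t = σ (X * gauge H t Y) ∧ F (t + Complex.I * β) = σ (gauge H t Y * X)

/-- A real function as a complex one. -/
def ofRealFun (f : C(Shift A, ℝ)) : C(Shift A, ℂ) :=
  ⟨fun x => (f x : ℂ), Complex.continuous_ofReal.comp f.continuous⟩

/-- The restriction of a state to the real continuous functions on `Σ_A` (which are all compactly
supported), a positive linear functional. -/
def stateRestrict (σ : CState (CKAlgebra A)) :
    CompactlySupportedContinuousMap (Shift A) ℝ →ₚ[ℝ] ℝ :=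
  PositiveLinearMap.mk₀
    { toFun := fun f => (σ (embed A (ofRealFun f.toContinuousMap))).re
      map_add' := fun f g => by
        have : ofRealFun (f + g).toContinuousMap
            = ofRealFun f.toContinuousMap + ofRealFun g.toContinuousMap := by
          ext x; simp [ofRealFun]
        rw [this, map_add, map_add, Complex.add_re]
      map_smul' := fun c f => by
        have : ofRealFun (c • f).toContinuousMap
            = (c : ℂ) • ofRealFun f.toContinuousMap := by
          ext x; simp [ofRealFun]
        rw [this, map_smul, map_smul]
        simp }
    (fun f hf => by
      let g : C(Shift A, ℂ) := ofRealFun ⟨fun x => Real.sqrt (f x),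
        Real.continuous_sqrt.comp f.continuous⟩
      have hg : ofRealFun f.toContinuousMap = star g * g := by
        ext x
        change ((f x : ℝ) : ℂ) = (starRingEnd ℂ) ((Real.sqrt (f x) : ℝ) : ℂ) * (Real.sqrt (f x) : ℝ)
        rw [Complex.conj_ofReal, ← Complex.ofReal_mul, Real.mul_self_sqrt (hf x)]
      change 0 ≤ (σ (embed A (ofRealFun f.toContinuousMap))).re
      rw [hg, map_mul, map_star]
      exact (Complex.le_def.1 (σ.nonneg _)).1)

/-- The measure `m_σ` on `Σ_A` that represents the restriction of `σ` to `C(Σ_A)`. -/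
def stateMeasure (σ : CState (CKAlgebra A)) : MeasureTheory.Measure (Shift A) :=
  RealRMK.rieszMeasure (stateRestrict σ)

theorem integral_stateMeasure (σ : CState (CKAlgebra A)) (f : C(Shift A, ℝ)) :
    ∫ x, f x ∂(stateMeasure σ) = (σ (embed A (ofRealFun f))).re :=
  RealRMK.integral_rieszMeasure (stateRestrict σ)
    (CompactlySupportedContinuousMap.continuousMapEquiv f)

variable (A) in
/-- The element `S_v S_w*` of `𝒪_A`. -/
def wordElement (v w : List I) : CKAlgebra A := wordProd (gen A) v * star (wordProd (gen A) w)

end CuntzKrieger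

end

/-! Everything rests on one exact identity. If the gauge action multiplies `Y` by `e^{itK}` for a
real continuous `K`, then σ(X e^{-βK} Y) = σ(Y X) for every `X` (`IsKMSState.apply_mul_comm`). The
KMS condition only speaks of a dense set that may miss `X` and `Y`, so the identity is reached by
approximation: the strip functions of nearby elements are close to one explicit entire function on
one edge and to another on the opposite edge, and the three lines theorem forces these two to
coincide (`eq_of_approx_on_strip`).

The covariance relation S_i f = (f ∘ θ) S_i, with θ the shift, shows that a word `v` of length n
satisfies the hypothesis, `K` being the Birkhoff sum of `H` of length n (`gauge_wordProd`). For |v|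
= |w| and v ≠ w this gives σ(S_v S_w*) = σ(S_w* e^{-βK} S_v) = 0, the ranges being orthogonal even
after multiplication by a function.

For |v| > |w| write v = v₁v₂ with |v₁| = |w|. Moving S_{v₁} around gives 0 unless v₁ = w, and then
leaves σ(b S_{v₂}) with b = S_w* e^{-βK} S_w, which is gauge invariant and commutes with C(Σ_A). Let
now `K` be the Birkhoff sum for v₂. Moving S_{v₂} once around the state inserts a factor e^{-βK};
iterating, forwards or backwards according to the sign of β, gives σ(b S_{v₂}) = σ(e^{-k|β|K} b
S_{v₂}) for all k. By Cauchy–Schwarz the square of its modulus is at most a constant times ∫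
e^{-2k|β|K} dm_σ, which tends to 0 because K ≥ H > 0 almost everywhere
(`IsKMSState.apply_mul_wordProd_eq_zero`). The case |v| < |w| follows by taking adjoints. -/

noncomputable section

namespace CuntzKrieger

/-! ### From the KMS condition on a dense set to an exact identity. -/

section KMSIdentity

open Complex Complex.HadamardThreeLines Filter Topology in
/-- Two functions on the strip `0 ≤ re z ≤ 1` agree at `1` if bounded analytic functions approximate
the first uniformly on `re z = 0` and the second uniformly on `re z = 1`. -/
theorem eq_of_approx_on_strip {G K : ℂ → ℂ} (hG : Differentiable ℂ G) (hK : Differentiable ℂ K)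
    (hGb : BddAbove ((norm ∘ G) '' verticalClosedStrip 0 1))
    (hKb : BddAbove ((norm ∘ K) '' verticalClosedStrip 0 1))
    (hF : ∀ ε > 0, ∃ F : ℂ → ℂ, DiffContOnCl ℂ F (verticalStrip 0 1) ∧
      BddAbove ((norm ∘ F) '' verticalClosedStrip 0 1) ∧
      (∀ z ∈ re ⁻¹' {0}, ‖F z - G z‖ ≤ ε) ∧ ∀ z ∈ re ⁻¹' {1}, ‖F z - K z‖ ≤ ε) :
    G 1 = K 1 := by
  obtain ⟨CG, hCG⟩ := hGb
  obtain ⟨CK, hCK⟩ := hKb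
  have hsub : ∀ {F E : ℂ → ℂ} {a b : ℝ}, a ∈ upperBounds ((norm ∘ F) '' verticalClosedStrip 0 1) →
      b ∈ upperBounds ((norm ∘ E) '' verticalClosedStrip 0 1) →
      ∀ z ∈ verticalClosedStrip 0 1, ‖F z - E z‖ ≤ a + b := fun ha hb z hz =>
    (norm_sub_le _ _).trans (add_le_add (ha ⟨z, hz, rfl⟩) (hb ⟨z, hz, rfl⟩))
  have key : ∀ x : ℝ, x ∈ Set.Ioo (0 : ℝ) 1 → G x = K x := by
    intro x hx
    have hxs : (x : ℂ) ∈ verticalClosedStrip 0 1 := ⟨hx.1.le, hx.2.le⟩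
    have hle : ∀ ε > 0, ‖G x - K x‖ ≤
        ε ^ (1 - x) * (ε + (CG + CK)) ^ x + (ε + (CG + CK)) ^ (1 - x) * ε ^ x := by
      intro ε hε
      obtain ⟨F, hFd, ⟨C, hC⟩, h0, h1⟩ := hF ε hε
      have hGK := hsub hCG hCK
      -- On the edge where `F` is not close to `G` it is close to `K`, so `F - G` is bounded there
      -- independently of `F`. The bound `C` of `F` depends on ε and serves only to make the three
      -- lines theorem applicable.
      have a1 := norm_le_interp_of_mem_verticalClosedStrip₀₁' (fun z => F z - G z)
        (a := ε) (b := ε + (CG + CK)) hxs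
        (hFd.sub hG.diffContOnCl) ⟨_, by rintro _ ⟨z, hz, rfl⟩; exact hsub hC hCG z hz⟩ h0
        (fun z hz => by
          have hz' : z ∈ verticalClosedStrip 0 1 := by
            simp only [Set.mem_preimage, Set.mem_singleton_iff] at hz
            simp [verticalClosedStrip, hz]
          calc ‖F z - G z‖ = ‖(F z - K z) - (G z - K z)‖ := by congr 1; ring
            _ ≤ _ := (norm_sub_le _ _).trans (add_le_add (h1 z hz) (hGK z hz')))
      have a2 := norm_le_interp_of_mem_verticalClosedStrip₀₁' (fun z => F z - K z)
        (a := ε + (CG + CK)) (b := ε) hxs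
        (hFd.sub hK.diffContOnCl) ⟨_, by rintro _ ⟨z, hz, rfl⟩; exact hsub hC hCK z hz⟩
        (fun z hz => by
          have hz' : z ∈ verticalClosedStrip 0 1 := by
            simp only [Set.mem_preimage, Set.mem_singleton_iff] at hz
            simp [verticalClosedStrip, hz]
          calc ‖F z - K z‖ = ‖(F z - G z) + (G z - K z)‖ := by congr 1; ring
            _ ≤ _ := (norm_add_le _ _).trans (add_le_add (h0 z hz) (hGK z hz'))) h1
      rw [ofReal_re] at a1 a2
      calc ‖G x - K x‖ = ‖(F x - K x) - (F x - G x)‖ := by congr 1; ring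
        _ ≤ ‖F x - K x‖ + ‖F x - G x‖ := norm_sub_le _ _
        _ ≤ _ := by linarith
    -- For `x` strictly inside the strip, each summand carries a positive power of ε.
    have hlim : Tendsto (fun ε : ℝ => ε ^ (1 - x) * (ε + (CG + CK)) ^ x +
        (ε + (CG + CK)) ^ (1 - x) * ε ^ x) (𝓝[>] 0) (𝓝 0) := by
      have hx1 : 0 < 1 - x := by linarith [hx.2]
      have hc : ContinuousAt (fun ε : ℝ => ε ^ (1 - x) * (ε + (CG + CK)) ^ x +
          (ε + (CG + CK)) ^ (1 - x) * ε ^ x) 0 := by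
        have i : ContinuousAt (fun ε : ℝ => ε) 0 := continuousAt_id
        have j : ContinuousAt (fun ε : ℝ => ε + (CG + CK)) 0 := by fun_prop
        exact ((i.rpow_const (.inr hx1.le)).mul (j.rpow_const (.inr hx.1.le))).add
          ((j.rpow_const (.inr hx1.le)).mul (i.rpow_const (.inr hx.1.le)))
      have := hc.tendsto
      rw [Real.zero_rpow hx1.ne', Real.zero_rpow hx.1.ne', zero_mul, mul_zero, add_zero] at this
      exact this.mono_left nhdsWithin_le_nhds
    have := ge_of_tendsto hlim (eventually_nhdsWithin_of_forall hle)
    exact sub_eq_zero.1 (norm_le_zero_iff.1 this)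
  -- The interpolation bound does not vanish in the limit at the edge itself; the value at 1 comes
  -- from continuity.
  have hx : Tendsto (fun x : ℝ => (x : ℂ)) (𝓝[<] 1) (𝓝 1) := by
    have := (Complex.continuous_ofReal.tendsto 1).mono_left (nhdsWithin_le_nhds (s := Set.Iio 1))
    simpa using this
  refine tendsto_nhds_unique ((hG.continuous.tendsto 1).comp hx)
    (((hK.continuous.tendsto 1).comp hx).congr' ?_)
  filter_upwards [Ioo_mem_nhdsLT (zero_lt_one' ℝ)] with x hx
  exact (key x hx).symm

/-! ### Elementary properties of states. -/

section State

variable {B : Type*} [CStarAlgebra B]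

/-- In the spectral order every nonnegative element has the form y*y, so a state is a positive
linear map and ⟨a, b⟩ = σ(a*b) is its GNS semi-inner product. -/
theorem CState.map_star_and_norm_le (σ : CState B) (a b : B) :
    σ (star a) = star (σ a) ∧
    ‖σ (star a * b)‖ ≤ √(σ (star a * a)).re * √(σ (star b * b)).re := by
  let := CStarAlgebra.spectralOrder B
  have := CStarAlgebra.spectralOrderedRing B
  let f : B →ₚ[ℂ] ℂ := PositiveLinearMap.mk₀ σ.toFunctional.toLinearMap fun x hx => by
    obtain ⟨y, rfl⟩ := CStarAlgebra.nonneg_iff_eq_star_mul_self.1 hx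
    exact σ.nonneg y
  exact ⟨map_star f a, norm_inner_le_norm (𝕜 := ℂ) (f.toPreGNS a) (f.toPreGNS b)⟩

/-- States are hermitian. -/
theorem CState.map_star (σ : CState B) (a : B) : σ (star a) = star (σ a) :=
  (σ.map_star_and_norm_le a a).1

/-- The Cauchy–Schwarz inequality for states. -/
theorem CState.norm_star_mul_le (σ : CState B) (a b : B) :
    ‖σ (star a * b)‖ ≤ √(σ (star a * a)).re * √(σ (star b * b)).re :=
  (σ.map_star_and_norm_le a b).2

theorem CState.norm_le (σ : CState B) (a : B) : ‖σ a‖ ≤ ‖a‖ := by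
  simpa [σ.norm_eq_one] using σ.toFunctional.le_opNorm a

end State

/-! ### The functions `e^{zK}` and the KMS identity. -/

variable {I : Type*} [Fintype I] [Nonempty I] {A : TransitionMatrix I}

/-- The function `e^{zK}`. -/
def cexpFun (K : C(Shift A, ℝ)) (z : ℂ) : C(Shift A, ℂ) :=
  ⟨fun x => Complex.exp (z * K x), Complex.continuous_exp.comp
    (continuous_const.mul (Complex.continuous_ofReal.comp K.continuous))⟩

/-- Identifying the pointwise exponential with that of the Banach algebra C(Σ_A) makes `z ↦ e^{zK}`
holomorphic in norm, not merely pointwise. -/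
theorem cexpFun_eq_exp (K : C(Shift A, ℝ)) (z : ℂ) :
    cexpFun K z = NormedSpace.exp (z • ofRealFun K) := by
  ext x
  have h := NormedSpace.map_exp (ContinuousMap.evalAlgHom ℂ ℂ x) (continuous_eval_const x)
    (z • ofRealFun K)
  refine Eq.trans ?_ h.symm
  rw [← Complex.exp_eq_exp_ℂ]
  rfl

theorem differentiable_cexpFun (K : C(Shift A, ℝ)) : Differentiable ℂ (cexpFun K) := by
  have h : cexpFun K = fun z => NormedSpace.exp (z • ofRealFun K) := funext (cexpFun_eq_exp K)
  rw [h]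
  exact fun z => (hasDerivAt_exp_smul_const (ofRealFun K) z).differentiableAt

theorem norm_cexpFun_le (K : C(Shift A, ℝ)) (z : ℂ) :
    ‖cexpFun K z‖ ≤ Real.exp (|z.re| * ‖K‖) := by
  refine (ContinuousMap.norm_le _ (Real.exp_pos _).le).2 fun x => ?_
  change ‖Complex.exp _‖ ≤ _
  rw [Complex.norm_exp, Real.exp_le_exp, Complex.re_mul_ofReal]
  calc z.re * K x ≤ |z.re * K x| := le_abs_self _
    _ = |z.re| * ‖K x‖ := abs_mul _ _
    _ ≤ _ := by gcongr; exact K.norm_coe_le_norm x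

theorem cexpFun_add (K : C(Shift A, ℝ)) (z w : ℂ) :
    cexpFun K (z + w) = cexpFun K z * cexpFun K w := by
  ext x
  change Complex.exp _ = Complex.exp _ * Complex.exp _
  rw [add_mul, Complex.exp_add]

theorem expFun_eq_cexpFun (K : C(Shift A, ℝ)) (t : ℝ) :
    expFun K t = cexpFun K (Complex.I * t) := rfl

theorem norm_embed_le (f : C(Shift A, ℂ)) : ‖embed A f‖ ≤ ‖f‖ :=
  NonUnitalStarAlgHom.norm_apply_le (embed A) f

theorem norm_gauge (H : C(Shift A, ℝ)) (t : ℝ) (Y : CKAlgebra A) : ‖gauge H t Y‖ = ‖Y‖ :=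
  StarAlgEquiv.norm_map (gauge H t) Y

theorem gauge_embed (H : C(Shift A, ℝ)) (t : ℝ) (f : C(Shift A, ℂ)) :
    gauge H t (embed A f) = embed A f := gaugeHom_embed H t f

/-- `embed` as a continuous linear map. -/
def embedL (A : TransitionMatrix I) : C(Shift A, ℂ) →L[ℂ] CKAlgebra A :=
  LinearMap.mkContinuous (embed A).toAlgHom.toLinearMap 1 fun f => by
    rw [one_mul]; exact norm_embed_le f

/-- The affine argument `c * z + d` covers both comparison functions of the KMS identity, one for
each edge of the strip. -/
theorem differentiable_state_cexp (K : C(Shift A, ℝ)) (σ : CState (CKAlgebra A))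
    (X Y : CKAlgebra A) (c d : ℂ) :
    Differentiable ℂ fun z : ℂ => σ (X * embed A (cexpFun K (c * z + d)) * Y) := by
  have h : Differentiable ℂ fun z : ℂ => embedL A (cexpFun K (c * z + d)) :=
    (embedL A).differentiable.comp ((differentiable_cexpFun K).comp (by fun_prop))
  exact σ.toFunctional.differentiable.comp ((h.const_mul X).mul_const Y)

/-- The bound depends on `z` only through its real part, hence is uniform on vertical strips. -/
theorem norm_state_cexp_le (K : C(Shift A, ℝ)) (σ : CState (CKAlgebra A))
    (X Y : CKAlgebra A) (z : ℂ) :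
    ‖σ (X * embed A (cexpFun K z) * Y)‖ ≤ ‖X‖ * Real.exp (|z.re| * ‖K‖) * ‖Y‖ := by
  refine (σ.norm_le _).trans ((norm_mul_le _ _).trans ?_)
  gcongr
  refine (norm_mul_le _ _).trans ?_
  gcongr
  exact (norm_embed_le _).trans (norm_cexpFun_le K z)

theorem norm_mul_sub_mul_le {B : Type*} [NormedRing B] (a b x y : B) :
    ‖a * b - x * y‖ ≤ ‖a - x‖ * ‖b‖ + ‖x‖ * ‖b - y‖ := by
  calc ‖a * b - x * y‖ = ‖(a - x) * b + x * (b - y)‖ := by congr 1; noncomm_ring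
    _ ≤ _ := (norm_add_le _ _).trans (add_le_add (norm_mul_le _ _) (norm_mul_le _ _))

/-- KMS states at inverse temperature zero are traces. -/
theorem IsKMSState.apply_comm {H : C(Shift A, ℝ)} {σ : CState (CKAlgebra A)}
    (hσ : IsKMSState H 0 σ) (X Y : CKAlgebra A) : σ (X * Y) = σ (Y * X) := by
  obtain ⟨D, hD, hF⟩ := hσ
  have hc : IsClosed {p : CKAlgebra A × CKAlgebra A | σ (p.1 * p.2) = σ (p.2 * p.1)} :=
    isClosed_eq (σ.toFunctional.continuous.comp (continuous_fst.mul continuous_snd))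
      (σ.toFunctional.continuous.comp (continuous_snd.mul continuous_fst))
  refine hc.closure_subset_iff.2 ?_ ((hD.prod hD) (X, Y))
  rintro ⟨X, Y⟩ ⟨hX, hY⟩
  obtain ⟨F, -, -, -, h⟩ := hF X hX Y hY
  have hg : gauge H 0 Y = Y := by
    have e : expFun H 0 = 1 := by
      ext x
      change Complex.exp _ = 1
      simp
    have h2 : gaugeHom H 0 = StarAlgHom.id ℂ (CKAlgebra A) :=
      hom_ext (continuous_lift _) continuous_id fun j => by
        rw [gaugeHom_gen, e, map_one, one_mul]; rfl
    exact DFunLike.congr_fun h2 Y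
  -- The strip has collapsed to a line, and both boundary formulas describe the same value `F 0`.
  have h0 := h 0
  rw [hg] at h0
  change σ (X * Y) = σ (Y * X)
  rw [← h0.1, ← h0.2]
  simp

open Complex.HadamardThreeLines in
/-- The KMS identity for elements on which the gauge action is multiplication by `e^{itK}`. -/
theorem IsKMSState.apply_mul_comm {H : C(Shift A, ℝ)} {β : ℝ} {σ : CState (CKAlgebra A)}
    (hσ : IsKMSState H β σ) (K : C(Shift A, ℝ)) {Y : CKAlgebra A}
    (hY : ∀ t, gauge H t Y = embed A (expFun K t) * Y) (X : CKAlgebra A) :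
    σ (X * embed A (cexpFun K (-β)) * Y) = σ (Y * X) := by
  have e0 : cexpFun K 0 = 1 := by
    ext x
    change Complex.exp _ = 1
    simp
  by_cases hβ : β = 0
  · subst hβ
    simpa [e0] using hσ.apply_comm X Y
  obtain ⟨D, hD, hF⟩ := hσ
  -- With t = iβz, the function `G` is σ(X α^t(Y)) on re z = 0, and `L` is σ(α^t(Y) X) at t = iβz -
  -- iβ on re z = 1. At z = 1 they are the two sides of the claim.
  let G : ℂ → ℂ := fun z => σ (X * embed A (cexpFun K (-β * z + 0)) * Y)
  let L : ℂ → ℂ := fun z => σ (1 * embed A (cexpFun K (-β * z + β)) * (Y * X))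
  have hstrip : ∀ z ∈ verticalClosedStrip 0 1, |z.re| ≤ 1 := fun z hz =>
    abs_le.2 ⟨by linarith [hz.1], hz.2⟩
  have hbdd : ∀ (P Q : CKAlgebra A) (d : ℝ), BddAbove ((norm ∘ fun z : ℂ =>
      σ (P * embed A (cexpFun K (-β * z + d)) * Q)) '' verticalClosedStrip 0 1) := by
    intro P Q d
    refine ⟨‖P‖ * Real.exp ((|β| + |d|) * ‖K‖) * ‖Q‖, ?_⟩
    rintro _ ⟨z, hz, rfl⟩
    refine (norm_state_cexp_le K σ P Q _).trans ?_
    gcongr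
    have hre : ((-β : ℂ) * z + d).re = -β * z.re + d := by simp
    rw [hre]
    calc |-β * z.re + d| ≤ |-β * z.re| + |d| := abs_add_le _ _
      _ = |β| * |z.re| + |d| := by rw [abs_mul, abs_neg]
      _ ≤ |β| * 1 + |d| := by gcongr; exact hstrip z hz
      _ = _ := by rw [mul_one]
  have h1 : G 1 = L 1 := by
    refine eq_of_approx_on_strip (differentiable_state_cexp K σ X Y _ _)
      (differentiable_state_cexp K σ _ _ _ _) (by simpa [G] using hbdd X Y 0) (hbdd _ _ β)
      fun ε hε => ?_
    -- Replacing both factors of a product costs at most δ(‖Y‖ + 1) + ‖X‖δ on one edge and δ(‖X‖ +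
    -- 1) + ‖Y‖δ on the other; δ ≤ 1 provides the +1. The gauge action is isometric, so this is
    -- uniform in `t`.
    obtain ⟨δ, hδ, hδ1, hδε⟩ : ∃ δ > 0, δ ≤ 1 ∧ δ * (‖X‖ + ‖Y‖ + 1) ≤ ε := by
      have hp : 0 < ‖X‖ + ‖Y‖ + 1 := by positivity
      refine ⟨min 1 (ε / (‖X‖ + ‖Y‖ + 1)), by positivity, min_le_left _ _, ?_⟩
      exact (le_div_iff₀ hp).1 (min_le_right _ _)
    obtain ⟨X', hX', hXX⟩ := hD.exists_dist_lt X hδ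
    obtain ⟨Y', hY', hYY⟩ := hD.exists_dist_lt Y hδ
    rw [dist_comm, dist_eq_norm] at hXX hYY
    obtain ⟨F, hFc, ⟨C, hC⟩, hFd, hFb⟩ := hF X' hX' Y' hY'
    -- The map `z ↦ iβz` carries the unit strip to the KMS strip for either sign of β.
    have him : ∀ z : ℂ, (Complex.I * β * z).im = β * z.re := fun z => by simp
    have hmap : ∀ z ∈ verticalClosedStrip 0 1, (Complex.I * β * z).im ∈ Set.uIcc 0 β := by
      intro z hz
      rw [him]
      rcases le_total 0 β with hβ | hβ
      · rw [Set.uIcc_of_le hβ]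
        exact ⟨mul_nonneg hβ hz.1, mul_le_of_le_one_right hβ hz.2⟩
      · rw [Set.uIcc_of_ge hβ]
        exact ⟨by nlinarith [hz.2], mul_nonpos_of_nonpos_of_nonneg hβ hz.1⟩
    have hn : ∀ t : ℝ, ‖gauge H t Y' - gauge H t Y‖ < δ := fun t => by
      rw [← map_sub, norm_gauge]; exact hYY
    have hX'le : ‖X'‖ ≤ ‖X‖ + 1 := by
      have := norm_add_le (X' - X) X
      rw [sub_add_cancel] at this
      linarith
    have hY'le : ‖Y'‖ ≤ ‖Y‖ + 1 := by
      have := norm_add_le (Y' - Y) Y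
      rw [sub_add_cancel] at this
      linarith
    refine ⟨fun z => F (Complex.I * β * z), ⟨?_, ?_⟩, ⟨C, ?_⟩, fun z hz => ?_, fun z hz => ?_⟩
    · refine hFd.comp (by fun_prop) fun z hz => ?_
      have h : (0 < z.re) ∧ z.re < 1 := hz
      change (Complex.I * β * z).im ∈ Set.uIoo 0 β
      rw [him]
      rcases lt_or_gt_of_ne hβ with h' | h'
      · rw [Set.uIoo_of_gt h']
        exact ⟨by nlinarith, by nlinarith⟩
      · rw [Set.uIoo_of_lt h']
        exact ⟨by nlinarith, by nlinarith⟩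
    · refine hFc.comp (by fun_prop) fun z hz => hmap z ?_
      have : closure (verticalStrip 0 1) ⊆ verticalClosedStrip 0 1 :=
        closure_minimal (Set.preimage_mono Set.Ioo_subset_Icc_self)
          (isClosed_Icc.preimage Complex.continuous_re)
      exact this hz
    · rintro _ ⟨z, hz, rfl⟩
      exact hC _ (hmap z hz)
    · have hz0 : z.re = 0 := hz
      have ez : Complex.I * β * z = ((-β * z.im : ℝ) : ℂ) := by
        apply Complex.ext <;> simp [hz0]
      have eG : G z = σ (X * gauge H (-β * z.im) Y) := by
        have : (-β * z + 0 : ℂ) = Complex.I * ((-β * z.im : ℝ) : ℂ) := by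
          apply Complex.ext <;> simp [hz0]
        simp only [G]
        rw [hY, expFun_eq_cexpFun, this, mul_assoc]
      change ‖F (Complex.I * β * z) - G z‖ ≤ ε
      rw [ez, (hFb _).1, eG, ← map_sub]
      refine (σ.norm_le _).trans ((norm_mul_sub_mul_le _ _ _ _).trans ?_)
      have := hn (-β * z.im)
      rw [norm_gauge]
      calc _ ≤ δ * (‖Y‖ + 1) + ‖X‖ * δ := by gcongr
        _ ≤ ε := by linarith
    · have hz1 : z.re = 1 := hz
      have ez : Complex.I * β * z = ((-β * z.im : ℝ) : ℂ) + Complex.I * β := by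
        apply Complex.ext <;> simp [hz1]
      have eL : L z = σ (gauge H (-β * z.im) Y * X) := by
        have : (-β * z + β : ℂ) = Complex.I * ((-β * z.im : ℝ) : ℂ) := by
          apply Complex.ext <;> simp [hz1]
        simp only [L]
        rw [hY, expFun_eq_cexpFun, this, one_mul, mul_assoc]
      change ‖F (Complex.I * β * z) - L z‖ ≤ ε
      rw [ez, (hFb _).2, eL, ← map_sub]
      refine (σ.norm_le _).trans ((norm_mul_sub_mul_le _ _ _ _).trans ?_)
      have := hn (-β * z.im)
      rw [norm_gauge]
      calc _ ≤ δ * (‖X‖ + 1) + ‖Y‖ * δ := by gcongr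
        _ ≤ ε := by linarith
  simpa [G, L, e0] using h1

end KMSIdentity

/-! ### Covariance of words with functions on the shift space, and the gauge action on words. -/

section Covariance

variable {I : Type*} {A : TransitionMatrix I}

/-- The shift map `θ` of `Σ_A`. -/
def shiftMap (A : TransitionMatrix I) : C(Shift A, Shift A) where
  toFun x := ⟨fun n => x.1 (n + 1), fun n => x.2 (n + 1)⟩
  continuous_toFun := by
    let : TopologicalSpace I := ⊥
    have h : Continuous fun x : {x : ℕ → I // ∀ n, A.a (x n) (x (n + 1)) = 1} =>
        (⟨fun n => x.1 (n + 1), fun n => x.2 (n + 1)⟩ :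
          {x : ℕ → I // ∀ n, A.a (x n) (x (n + 1)) = 1}) :=
      Continuous.subtype_mk (continuous_pi fun n =>
        (continuous_apply (A := fun _ => I) (n + 1)).comp continuous_subtype_val) _
    exact h

theorem shiftMap_mem_cylinder {i : I} {u : List I} {x : Shift A}
    (hx : x ∈ cylinder A (i :: u)) : shiftMap A x ∈ cylinder A u :=
  ((cylinder_cons_iff A i u x).1 hx).2

variable [Fintype I] [Nonempty I]

section Family

variable {B : Type*} [CStarAlgebra B] {S : I → B}

/-- The shifted sample point of `u` and the sample point of `u.tail` lie in the same cylinder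
`[u.tail]`, so uniform continuity of `f` makes the two Riemann sums asymptotically equal. -/
theorem IsCKFamily.tendsto_cylSum_tail (hS : IsCKFamily A S) (f : C(Shift A, ℂ)) :
    Filter.Tendsto (fun n => cylSum S (n + 1) fun u => sample A f u.tail) Filter.atTop
      (nhds (hS.funEmbed (f.comp (shiftMap A)))) := by
  have h := (hS.tendsto_funEmbed (f.comp (shiftMap A))).comp (Filter.tendsto_add_atTop_nat 1)
  refine (h.congr_dist ?_)
  rw [Metric.tendsto_atTop]
  intro ε hε
  obtain ⟨N, hN⟩ := exists_uniform A f (half_pos hε)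
  refine ⟨N + 1, fun n hn => ?_⟩
  rw [Real.dist_0_eq_abs, abs_of_nonneg dist_nonneg, dist_eq_norm]
  change ‖hS.cylHom (n + 1) (sample A (f.comp (shiftMap A))) -
    hS.cylHom (n + 1) (fun u => sample A f u.tail)‖ < ε
  rw [← map_sub]
  refine lt_of_le_of_lt (hS.norm_cylSum_le n _ (half_pos hε).le fun u hu hw => ?_) (half_lt_self hε)
  obtain ⟨i, u, rfl⟩ : ∃ i u', u = i :: u' := List.exists_cons_of_ne_nil hw.1
  have hlen : u.length = n := by simpa using hu
  have hw' : u ∈ words A :=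
    ⟨List.ne_nil_of_length_pos (by omega), hw.2.tail⟩
  refine (hN _ _ fun k hk => ?_).le
  rw [shiftMap_mem_cylinder (pickPoint_mem A hw) k (by omega)]
  exact (pickPoint_mem A hw' k (by omega)).symm

/-- `∑ i, S_i f S_i* = f ∘ θ`. -/
theorem IsCKFamily.sum_conj_funEmbed (hS : IsCKFamily A S) (f : C(Shift A, ℂ)) :
    ∑ i, S i * hS.funEmbed f * star (S i) = hS.funEmbed (f.comp (shiftMap A)) := by
  refine tendsto_nhds_unique ?_ (hS.tendsto_cylSum_tail f)
  -- By the recursion defining `cylSum`, the tail sums are the sums over `i` of the Riemann sums for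
  -- `f` conjugated by `S i`.
  exact tendsto_finsetSum _ fun i _ => ((hS.tendsto_funEmbed f).const_mul _).mul_const _

theorem IsCKFamily.source_commute_funEmbed (hS : IsCKFamily A S) (f : C(Shift A, ℂ)) (i : I) :
    Commute (star (S i) * S i) (hS.funEmbed f) := by
  rw [hS.star_mul_self]
  exact Commute.sum_left _ _ _ fun j _ => Commute.smul_left (hS.funEmbed_commute f j) _

/-- The covariance relation `S_i f = (f ∘ θ) S_i`. -/
theorem IsCKFamily.mul_funEmbed (hS : IsCKFamily A S) (f : C(Shift A, ℂ)) (i : I) :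
    S i * hS.funEmbed f = hS.funEmbed (f.comp (shiftMap A)) * S i := by
  -- Orthogonality of ranges leaves S_i f S_i* S_i, where `f` moves past the source projection.
  rw [← hS.sum_conj_funEmbed, Finset.sum_mul, Finset.sum_eq_single i]
  · rw [mul_assoc, mul_assoc, ← (hS.source_commute_funEmbed f i).eq, ← mul_assoc, ← mul_assoc,
      hS.partialIsometry]
  · intro j _ hj
    rw [mul_assoc, hS.star_mul_eq_zero hj, mul_zero]
  · simp

theorem IsCKFamily.wordProd_mul_funEmbed (hS : IsCKFamily A S) (w : List I) (f : C(Shift A, ℂ)) :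
    wordProd S w * hS.funEmbed f
      = hS.funEmbed ((fun g : C(Shift A, ℂ) => g.comp (shiftMap A))^[w.length] f)
        * wordProd S w := by
  induction w with
  | nil => simp [wordProd]
  | cons i w ih =>
    have e : wordProd S (i :: w) = S i * wordProd S w := by simp [wordProd]
    rw [e, mul_assoc, ih, ← mul_assoc, hS.mul_funEmbed, mul_assoc, List.length_cons,
      Function.iterate_succ_apply']

/-- S_w S_w* is the image of a cylinder indicator, hence commutes with the source projection of the
letter put in front. No admissibility of `w` is needed. -/
theorem IsCKFamily.wordProd_partialIsometry (hS : IsCKFamily A S) (w : List I) :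
    wordProd S w * star (wordProd S w) * wordProd S w = wordProd S w := by
  induction w with
  | nil => simp [wordProd]
  | cons i w ih =>
    have e : wordProd S (i :: w) = S i * wordProd S w := by simp [wordProd]
    have hc := hS.source_commute_funEmbed (cylinderIndicator A w) i
    rw [hS.funEmbed_cylinder] at hc
    calc wordProd S (i :: w) * star (wordProd S (i :: w)) * wordProd S (i :: w)
        = S i * ((wordProd S w * star (wordProd S w)) * (star (S i) * S i)) * wordProd S w := by
          simp only [e, star_mul, mul_assoc]
      _ = (S i * star (S i) * S i) * (wordProd S w * star (wordProd S w) * wordProd S w) := by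
          rw [← hc.eq]; simp only [mul_assoc]
      _ = _ := by rw [ih, hS.partialIsometry, e]

/-- Distinct first letters have orthogonal ranges. A common first letter leaves its source
projection in the middle, which is moved past S_v S_v* so that the shorter words meet. -/
theorem IsCKFamily.star_wordProd_mul_eq_zero (hS : IsCKFamily A S) {v w : List I}
    (hl : v.length = w.length) (hne : v ≠ w) : star (wordProd S w) * wordProd S v = 0 := by
  classical
  induction v generalizing w with
  | nil => exact absurd (List.length_eq_zero_iff.1 hl.symm).symm hne
  | cons i v ih =>
    obtain ⟨j, w, rfl⟩ : ∃ j w', w = j :: w' :=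
      List.exists_cons_of_ne_nil (List.ne_nil_of_length_pos (by simp [← hl]))
    have e : ∀ (i : I) w, wordProd S (i :: w) = S i * wordProd S w := fun i w => by simp [wordProd]
    rw [e, e, star_mul, mul_assoc, ← mul_assoc (star (S j))]
    by_cases hij : j = i
    · subst hij
      have hl' : v.length = w.length := by simpa using hl
      have hne' : v ≠ w := fun h => hne (by rw [h])
      have hc := hS.source_commute_funEmbed (cylinderIndicator A v) j
      rw [hS.funEmbed_cylinder] at hc
      calc star (wordProd S w) * (star (S j) * S j * wordProd S v)
          = star (wordProd S w) * ((star (S j) * S j) * (wordProd S v * star (wordProd S v)))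
            * wordProd S v := by
            conv_lhs => rw [← hS.wordProd_partialIsometry v]
            simp only [mul_assoc]
        _ = (star (wordProd S w) * wordProd S v) * star (wordProd S v) * (star (S j) * S j)
            * wordProd S v := by rw [hc.eq]; simp only [mul_assoc]
        _ = 0 := by rw [ih hl' hne']; simp
    · rw [hS.star_mul_eq_zero hij]; simp

/-- Words of equal length that differ have orthogonal ranges, even after multiplication by a
function. -/
theorem IsCKFamily.star_wordProd_mul_funEmbed_mul_eq_zero (hS : IsCKFamily A S) {v w : List I}
    (hl : v.length = w.length) (hne : v ≠ w) (f : C(Shift A, ℂ)) :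
    star (wordProd S w) * hS.funEmbed f * wordProd S v = 0 := by
  have hc : hS.funEmbed f * (wordProd S v * star (wordProd S v))
      = wordProd S v * star (wordProd S v) * hS.funEmbed f := by
    rw [← hS.funEmbed_cylinder, ← map_mul, ← map_mul, mul_comm]
  calc star (wordProd S w) * hS.funEmbed f * wordProd S v
      = star (wordProd S w) * (hS.funEmbed f * (wordProd S v * star (wordProd S v)))
        * wordProd S v := by
        conv_lhs => rw [← hS.wordProd_partialIsometry v]
        simp only [mul_assoc]
    _ = (star (wordProd S w) * wordProd S v) * star (wordProd S v) * hS.funEmbed f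
        * wordProd S v := by rw [hc]; simp only [mul_assoc]
    _ = 0 := by rw [hS.star_wordProd_mul_eq_zero hl hne]; simp

/-- `S_w* f S_w` commutes with the functions on `Σ_A`. -/
theorem IsCKFamily.commute_conj_funEmbed (hS : IsCKFamily A S) (w : List I)
    (f g : C(Shift A, ℂ)) :
    Commute (star (wordProd S w) * hS.funEmbed f * wordProd S w) (hS.funEmbed g) := by
  -- Carrying `g` through S_w turns it into g ∘ θⁿ, which commutes with `f`; the adjoint relation,
  -- applied to `star g`, carries it out through S_w*.
  set T := (fun h : C(Shift A, ℂ) => h.comp (shiftMap A))^[w.length] with hT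
  have h1 := hS.wordProd_mul_funEmbed w g
  have hstar : ∀ n, ((fun h : C(Shift A, ℂ) => h.comp (shiftMap A))^[n] (star g))
      = star ((fun h : C(Shift A, ℂ) => h.comp (shiftMap A))^[n] g) := fun n => by
    induction n with
    | zero => rfl
    | succ n ih => rw [Function.iterate_succ_apply', Function.iterate_succ_apply', ih]; rfl
  have h2 := congrArg star (hS.wordProd_mul_funEmbed w (star g))
  rw [hstar, star_mul, star_mul, ← map_star, ← map_star, star_star, star_star] at h2
  calc star (wordProd S w) * hS.funEmbed f * wordProd S w * hS.funEmbed g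
      = star (wordProd S w) * (hS.funEmbed f * hS.funEmbed (T g)) * wordProd S w := by
        rw [mul_assoc _ (wordProd S w), h1]; simp only [mul_assoc]; rfl
    _ = (star (wordProd S w) * hS.funEmbed (T g)) * hS.funEmbed f * wordProd S w := by
        rw [← map_mul, mul_comm, map_mul]; simp only [mul_assoc]
    _ = _ := by rw [← h2]; simp only [mul_assoc]

end Family

/-- The Birkhoff sum `∑_{k<n} H ∘ θ^k`. -/
def shiftSum (H : C(Shift A, ℝ)) : ℕ → C(Shift A, ℝ)
  | 0 => 0
  | n + 1 => H + (shiftSum H n).comp (shiftMap A)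

/-- Each letter contributes a factor e^{itH}; moving it left past the preceding letters composes it
with the shift, which builds up the Birkhoff sum. -/
theorem gauge_wordProd (H : C(Shift A, ℝ)) (w : List I) (t : ℝ) :
    gauge H t (wordProd (gen A) w)
      = embed A (expFun (shiftSum H w.length) t) * wordProd (gen A) w := by
  induction w with
  | nil =>
    have e : expFun (A := A) 0 t = 1 := by
      ext x
      change Complex.exp (Complex.I * t * ((0 : ℝ) : ℂ)) = 1
      simp
    simp [wordProd, shiftSum, e]
  | cons i w ih =>
    have e : wordProd (gen A) (i :: w) = gen A i * wordProd (gen A) w := by simp [wordProd]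
    have e' : expFun (shiftSum H (w.length + 1)) t
        = expFun H t * (expFun (shiftSum H w.length) t).comp (shiftMap A) := by
      ext x
      change Complex.exp (Complex.I * t * ((H x + shiftSum H w.length (shiftMap A x) : ℝ) : ℂ))
        = Complex.exp _ * Complex.exp _
      rw [← Complex.exp_add]
      push_cast
      ring_nf
    rw [e, map_mul, gauge_gen, ih, mul_assoc, ← mul_assoc (gen A i),
      show gen A i * embed A (expFun (shiftSum H w.length) t) = _ from
        (isCKFamily_gen A).mul_funEmbed _ i, List.length_cons, e', map_mul]
    simp only [mul_assoc]
    rfl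

/-- Used to show that the zero set of a nonempty Birkhoff sum lies in that of `H`, so is null as
well. -/
theorem le_shiftSum {H : C(Shift A, ℝ)} (hH : ∀ x, 0 ≤ H x) (n : ℕ) (x : Shift A) :
    H x ≤ shiftSum H (n + 1) x := by
  have h : ∀ n x, 0 ≤ shiftSum H n x := fun n => by
    induction n with
    | zero => exact fun _ => le_rfl
    | succ n ih => exact fun x => add_nonneg (hH x) (ih _)
  exact le_add_of_nonneg_right (h n _)

/-- `S_w* f S_w` is fixed by the gauge action. -/
theorem gauge_conj_embed (H : C(Shift A, ℝ)) (w : List I) (f : C(Shift A, ℂ)) (t : ℝ) :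
    gauge H t (star (wordProd (gen A) w) * embed A f * wordProd (gen A) w)
      = star (wordProd (gen A) w) * embed A f * wordProd (gen A) w := by
  set K := shiftSum H w.length
  have h : star (embed A (expFun K t)) * embed A f * embed A (expFun K t) = embed A f := by
    rw [← map_star, ← map_mul, ← map_mul, mul_right_comm, star_expFun_mul, one_mul]
  rw [map_mul, map_mul, map_star, gauge_wordProd, gauge_embed, star_mul]
  calc _ = star (wordProd (gen A) w) * (star (embed A (expFun K t)) * embed A f *
        embed A (expFun K t)) * wordProd (gen A) w := by simp only [mul_assoc]; rfl
    _ = _ := by rw [h]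

end Covariance

/-! ### Vanishing of KMS states on `S_v S_w*`. -/

section Vanishing

variable {I : Type*} [Fintype I] [Nonempty I] {A : TransitionMatrix I}
  {H : C(Shift A, ℝ)} {β : ℝ} {σ : CState (CKAlgebra A)}

instance (σ : CState (CKAlgebra A)) : MeasureTheory.IsFiniteMeasure (stateMeasure σ) :=
  inferInstanceAs (MeasureTheory.IsFiniteMeasure (RealRMK.rieszMeasure (stateRestrict σ)))

/-- Elements fixed by the gauge action are central for a KMS state. -/
theorem IsKMSState.apply_mul_comm_of_gauge_eq (hσ : IsKMSState H β σ) {Y : CKAlgebra A}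
    (hY : ∀ t, gauge H t Y = Y) (X : CKAlgebra A) : σ (X * Y) = σ (Y * X) := by
  have e : ∀ z, cexpFun (A := A) 0 z = 1 := fun z => by
    ext x
    change Complex.exp (z * ((0 : ℝ) : ℂ)) = 1
    simp
  have h := hσ.apply_mul_comm 0 (Y := Y)
    (fun t => by rw [hY, expFun_eq_cexpFun, e, map_one, one_mul]) X
  rwa [e, map_one, mul_one] at h

theorem IsKMSState.apply_mul_wordProd (hσ : IsKMSState H β σ) (v : List I) (X : CKAlgebra A) :
    σ (X * embed A (cexpFun (shiftSum H v.length) (-β)) * wordProd (gen A) v)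
      = σ (wordProd (gen A) v * X) :=
  hσ.apply_mul_comm _ (gauge_wordProd H v) X

theorem IsKMSState.apply_wordElement_of_length_eq (hσ : IsKMSState H β σ) {v w : List I}
    (hl : v.length = w.length) (hne : v ≠ w) : σ (wordElement A v w) = 0 := by
  rw [wordElement, ← hσ.apply_mul_wordProd v]
  exact (congrArg σ ((isCKFamily_gen A).star_wordProd_mul_funEmbed_mul_eq_zero hl hne _)).trans
    (map_zero _)

/-- Dominated convergence: the integrands e^{-kcK} are at most 1 and tend to 0 wherever K > 0, hence
almost everywhere. -/
theorem tendsto_state_cexpFun {K : C(Shift A, ℝ)} (hK : ∀ x, 0 ≤ K x)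
    (hm : stateMeasure σ {x | K x = 0} = 0) {c : ℝ} (hc : 0 < c) :
    Filter.Tendsto (fun k : ℕ => (σ (embed A (cexpFun K ((-(k * c) : ℝ) : ℂ)))).re) Filter.atTop
      (nhds 0) := by
  have h : ∀ k : ℕ, (σ (embed A (cexpFun K ((-(k * c) : ℝ) : ℂ)))).re
      = ∫ x, Real.exp (-(k * c) * K x) ∂(stateMeasure σ) := fun k => by
    let g : C(Shift A, ℝ) := ⟨fun x => Real.exp (-(k * c) * K x), by fun_prop⟩
    have e : cexpFun K ((-(k * c) : ℝ) : ℂ) = ofRealFun g := by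
      ext x
      change Complex.exp _ = ((Real.exp _ : ℝ) : ℂ)
      push_cast
      rfl
    rw [e, ← integral_stateMeasure]
    rfl
  simp only [h]
  rw [← MeasureTheory.integral_zero (Shift A) ℝ (μ := stateMeasure σ)]
  refine MeasureTheory.tendsto_integral_of_dominated_convergence (fun _ => 1)
    (fun k => (Continuous.aestronglyMeasurable (by fun_prop))) (MeasureTheory.integrable_const 1)
    (fun k => .of_forall fun x => ?_) ?_
  · rw [Real.norm_of_nonneg (Real.exp_pos _).le, Real.exp_le_one_iff]
    have : 0 ≤ k * c * K x := mul_nonneg (by positivity) (hK x)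
    linarith
  · have hae : ∀ᵐ x ∂(stateMeasure σ), K x ≠ 0 := MeasureTheory.measure_eq_zero_iff_ae_notMem.1 hm
    filter_upwards [hae] with x hx
    have hpos : 0 < c * K x := mul_pos hc ((hK x).lt_of_ne hx.symm)
    refine Real.tendsto_exp_atBot.comp ?_
    have := (tendsto_natCast_atTop_atTop (R := ℝ)).const_mul_atTop_of_neg (neg_neg_of_pos hpos)
    exact this.congr fun k => by ring

/-- Invariance of `b` lets it pass around the state freely, while S_u picks up e^{-βK}; commutation
with C(Σ_A) collects these factors on the left. -/
theorem IsKMSState.apply_mul_wordProd_eq_zero (hσ : IsKMSState H β σ) (hβ : β ≠ 0)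
    (hH : ∀ x, 0 ≤ H x) (hm : stateMeasure σ {x | H x = 0} = 0) {u : List I} (hu : u ≠ [])
    {b : CKAlgebra A} (hb : ∀ t, gauge H t b = b) (hbc : ∀ f, Commute b (embed A f)) :
    σ (b * wordProd (gen A) u) = 0 := by
  set K := shiftSum H u.length with hKdef
  have hHK : ∀ x, H x ≤ K x := fun x => by
    obtain ⟨n, hn⟩ := Nat.exists_eq_succ_of_ne_zero (mt List.length_eq_zero_iff.1 hu)
    rw [hKdef, hn]
    exact le_shiftSum hH n x
  have hK : ∀ x, 0 ≤ K x := fun x => (hH x).trans (hHK x)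
  have hmK : stateMeasure σ {x | K x = 0} = 0 :=
    MeasureTheory.measure_mono_null (fun x (hx : K x = 0) =>
      le_antisymm ((hHK x).trans hx.le) (hH x)) hm
  have step : ∀ f, σ (embed A f * (b * wordProd (gen A) u))
      = σ (embed A (f * cexpFun K (-β)) * (b * wordProd (gen A) u)) := fun f => by
    have h1 := hσ.apply_mul_comm_of_gauge_eq (Y := embed A f * b)
      (fun t => by rw [map_mul, gauge_embed, hb]) (wordProd (gen A) u)
    have h2 := hσ.apply_mul_wordProd u (embed A f * b)
    rw [h1, mul_assoc (embed A f), (hbc _).eq] at h2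
    rw [map_mul (embed A)]
    simpa only [mul_assoc] using h2.symm
  let c : ℕ → C(Shift A, ℂ) := fun k => cexpFun K ((-(k * |β|) : ℝ) : ℂ)
  have hiter : ∀ k, σ (b * wordProd (gen A) u) = σ (embed A (c k) * (b * wordProd (gen A) u)) := by
    intro k
    induction k with
    | zero =>
      have : c 0 = 1 := by
        ext x
        change Complex.exp _ = 1
        simp
      rw [this, map_one, one_mul]
    | succ k ih =>
      rw [ih]
      rcases lt_or_gt_of_ne hβ with h | h
      -- For β < 0 the inserted factor e^{-βK} grows, so the step is read backwards, starting from
      -- `c (k + 1)`.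
      · have e : c (k + 1) * cexpFun K (-β) = c k := by
          rw [← cexpFun_add]
          congr 1
          rw [abs_of_neg h]
          push_cast
          ring
        rw [step (c (k + 1)), e]
      · have e : c k * cexpFun K (-β) = c (k + 1) := by
          rw [← cexpFun_add]
          congr 1
          rw [abs_of_pos h]
          push_cast
          ring
        rw [step (c k), e]
  -- The Cauchy–Schwarz bound for σ(c_k · b S_u); the 2 comes from squaring the self-adjoint
  -- function c_k.
  have hlim : Filter.Tendsto (fun k : ℕ => √(σ (embed A (cexpFun K ((-(k * (2 * |β|)) : ℝ) : ℂ)))).re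
      * √(σ (star (b * wordProd (gen A) u) * (b * wordProd (gen A) u))).re) Filter.atTop
      (nhds 0) := by
    have h := (Real.continuous_sqrt.tendsto 0).comp
      (tendsto_state_cexpFun hK hmK (c := 2 * |β|) (by positivity))
    rw [Real.sqrt_zero] at h
    simpa using! h.mul_const _
  refine norm_le_zero_iff.1 (ge_of_tendsto hlim (.of_forall fun k => ?_))
  have hs : star (c k) = c k := by
    ext x
    change (starRingEnd ℂ) (Complex.exp (((-(k * |β|) : ℝ) : ℂ) * (K x : ℂ))) = Complex.exp _
    rw [← Complex.exp_conj, map_mul, Complex.conj_ofReal, Complex.conj_ofReal]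
  have hcs := σ.norm_star_mul_le (embed A (c k)) (b * wordProd (gen A) u)
  have e : c k * c k = cexpFun K ((-(k * (2 * |β|)) : ℝ) : ℂ) := by
    rw [← cexpFun_add]
    congr 1
    push_cast
    ring
  rwa [← map_star, hs, ← hiter, ← map_mul, e] at hcs

theorem IsKMSState.apply_wordElement_of_length_lt (hσ : IsKMSState H β σ) (hβ : β ≠ 0)
    (hH : ∀ x, 0 ≤ H x) (hm : stateMeasure σ {x | H x = 0} = 0) {v w : List I}
    (hl : w.length < v.length) : σ (wordElement A v w) = 0 := by
  obtain ⟨v₁, v₂, rfl, hv₁, hv₂⟩ : ∃ v₁ v₂, v = v₁ ++ v₂ ∧ v₁.length = w.length ∧ v₂ ≠ [] :=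
    ⟨v.take w.length, v.drop w.length, (List.take_append_drop _ _).symm,
      by simp [hl.le], List.ne_nil_of_length_pos (by simp [hl])⟩
  have e : wordProd (gen A) (v₁ ++ v₂) = wordProd (gen A) v₁ * wordProd (gen A) v₂ := by
    simp [wordProd]
  -- Moving only S_{v₁} to the right end places it next to S_w*, with a function in between.
  rw [wordElement, e, mul_assoc, ← hσ.apply_mul_wordProd v₁, mul_assoc, mul_assoc, ← mul_assoc (star _)]
  set f := cexpFun (shiftSum H v₁.length) (-β)
  by_cases hw : v₁ = w
  · subst hw
    rw [hσ.apply_mul_comm_of_gauge_eq (gauge_conj_embed H v₁ f)]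
    exact hσ.apply_mul_wordProd_eq_zero hβ hH hm hv₂ (gauge_conj_embed H v₁ f)
      ((isCKFamily_gen A).commute_conj_funEmbed v₁ f)
  · rw [show star (wordProd (gen A) w) * embed A f * wordProd (gen A) v₁ = 0 from
      (isCKFamily_gen A).star_wordProd_mul_funEmbed_mul_eq_zero hv₁ hw f, mul_zero, map_zero]

theorem IsKMSState.apply_wordElement_of_length_ne (hσ : IsKMSState H β σ) (hβ : β ≠ 0)
    (hH : ∀ x, 0 ≤ H x) (hm : stateMeasure σ {x | H x = 0} = 0) {v w : List I}
    (hl : v.length ≠ w.length) : σ (wordElement A v w) = 0 := by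
  rcases lt_or_gt_of_ne hl with h | h
  · have e : wordElement A v w = star (wordElement A w v) := by simp [wordElement]
    rw [e, σ.map_star, hσ.apply_wordElement_of_length_lt hβ hH hm h, star_zero]
  · exact hσ.apply_wordElement_of_length_lt hβ hH hm h

end Vanishing

end CuntzKrieger

end

open CuntzKrieger in
theorem fact2p10 {I : Type*} [Fintype I] [Nontrivial I] (A : TransitionMatrix I)
    (H : C(Shift A, ℝ)) (β : ℝ) (σ : CState (CKAlgebra A)) (hσ : IsKMSState H β σ) :
    (∀ v ∈ words A, ∀ w ∈ words A, v.length = w.length → v ≠ w → σ (wordElement A v w) = 0) ∧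
    (β ≠ 0 → (∀ x, 0 ≤ H x) → stateMeasure σ {x | H x = 0} = 0 →
      (∀ v ∈ words A, ∀ w ∈ words A, v ≠ w → σ (wordElement A v w) = 0) ∧
      ∀ X ∈ closure (Submodule.span ℂ {Y : CKAlgebra A | ∃ v ∈ words A, ∃ w ∈ words A,
          v.length ≠ w.length ∧ Y = wordElement A v w} : Set (CKAlgebra A)),
        σ X = 0) := by
  refine ⟨fun v _ w _ => hσ.apply_wordElement_of_length_eq, fun hβ hH hm => ⟨?_, ?_⟩⟩
  · intro v _ w _ hne
    by_cases hl : v.length = w.length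
    · exact hσ.apply_wordElement_of_length_eq hl hne
    · exact hσ.apply_wordElement_of_length_ne hβ hH hm hl
  · have hle : Submodule.span ℂ {Y : CKAlgebra A | ∃ v ∈ words A, ∃ w ∈ words A,
        v.length ≠ w.length ∧ Y = wordElement A v w} ≤ LinearMap.ker σ.toFunctional.toLinearMap :=
      Submodule.span_le.2 fun _ ⟨v, _, w, _, hl, h⟩ => by
        rw [h]
        exact hσ.apply_wordElement_of_length_ne hβ hH hm hl
    intro X hX
    exact closure_minimal hle σ.toFunctional.isClosed_ker hX
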